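/- **Setting.** Consider an episodic POMDP with horizon $H\ge 1$, measurable state space $\mathcal S$, measurable observation space $\mathcal O$, a finite action set $\mathcal A$ with $|\mathcal A|=A\ge 2$, a fixed initial state $s_0$, emission distributions $\mathbb O_h(\cdot\mid s)$, reward distributions $\mathbb Y_h(\cdot\mid s,a)$ on $[0,1]$ with means $r_h(s,a)$, and deterministic transitions $s_{h+1}=p_h(s_h,a_h)$. Only the rewards of steps $0,\dots,H-1$ count; for a given $K\ge 1$ the process runs for the steps $0,\dots,H+K-2$, so that $o_{h:h+K-1}$ is defined for every $h<H$. Let $Q^\star_H=0$, $Q^\star_h(s,a)=r_h(s,a)+\max_{a'}Q^\star_{h+1}(p_h(s,a),a')$, $V^\star_h(s)=\max_aQ^\star_h(s,a)$ and $\mathrm{gap}_h(s,a)=V^\star_h(s)-Q^\star_h(s,a)$. **Assumptions.** Let $\phi:\mathcal S\to\mathbb R^{d_s}$ be a state feature and $\psi:\mathcal O^K\to\mathbb R^d$ ($d\ge1$) a measurable feature with $\|\psi\|\le 1$. (i) Linear $Q^\star$: for all $h<H$ and $a$ there is $w^\star_{a;h}$ with $\|w^\star_{a;h}\|\le W$ and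 $Q^\star_h(s,a)=\langle w^\star_{a;h},\phi(s)\rangle$ for all $s$. (ii) Gap: every positive value $\mathrm{gap}_h(s,a)$ with $h<H$ is at least $\Delta$. (iii) $K$-step observability: for every $h<H$ there are a left-invertible matrix $G_h\in\mathbb R^{d\times d_s}$ and an (unknown) action sequence $a^\diamond_{h:h+K-2}\in\mathcal A^{K-1}$ with $\mathbb E[\psi(o_{h:h+K-1})\mid s_h=s;a^\diamond_{h:h+K-2}]=G_h\phi(s)$ for all $s$. Put $\Theta=W/\min_{h<H}\eta(G_h)$, where $\eta$ denotes the smallest singular value. **Algorithm** (parameters $\lambda,\varepsilon>0$, $M\ge1$). For each $h<H$ keep a data set $\mathcal D_h$, initially empty, of pairs $(\hat x,(y_a)_{a\in\mathcal A})$; put $\Sigma_h=\lambda I+\sum\hat x\hat x^\top$, $\hat\theta_{a;h}=\Sigma_h^{-1}\sum y_a\hat x$ (sums over $\mathcal D_h$) and $\|x\|_{\Sigma_h^{-1}}=(x^\top\Sigma_h^{-1}x)^{1/2}$. The *feature estimate* $\hat x_h(a_{0:h-1})\in\mathbb R^{dA^{K-1}}$ stacks, over all $b\in\mathcal A^{K-1}$,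 the mean of $\psi(o_{h:h+K-1})$ over $M$ fresh episodes executing $a_{0:h-1}$ and then $b$. The *reward estimate* $\hat r_h(a_{0:h})$ is the mean of the reward of step $h$ over $M$ fresh episodes executing $a_{0:h}$. *Exploring* at $(h,a_{0:h-1},\hat x)$ means: for every $a'\in\mathcal A$ in turn compute $y_{a'}=\hat r_h(a_{0:h-1},a')+\mathrm{ComputeV}(h+1;a_{0:h-1},a')$, then add $(\hat x,(y_{a'})_{a'})$ to $\mathcal D_h$. - $\mathrm{ComputeV}(h;a_{0:h-1})$: if $h=H$ return $0$. If $h=H-1$ return $\max_{a'}\hat r_h(a_{0:h-1},a')$. Otherwise form $\hat x=\hat x_h(a_{0:h-1})$. If $\|\hat x\|_{\Sigma_h^{-1}}\le\varepsilon$, let $a_h\in\arg\max_a\langle\hat\theta_{a;h},\hat x\rangle$ and return $\hat r_h(a_{0:h})+\mathrm{ComputeV}(h+1;a_{0:h})$. If not, explore at $(h,a_{0:h-1},\hat x)$ and return $\max_{a'}y_{a'}$. - Main loop: for $h=0,\dots,H-1$ form $\hat x_h(a_{0:h-1})$ and let $a_h\in\arg\max_a\langle\hat\theta_{a;h},\hat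 x_h(a_{0:h-1})\rangle$. If $\|\hat x_h(a_{0:h-1})\|_{\Sigma_h^{-1}}\le\varepsilon$ for all $h$, stop and return $a_{0:H-1}$. Otherwise explore at $(h,a_{0:h-1},\hat x_h(a_{0:h-1}))$ for the smallest $h$ violating this, and repeat. Ties in $\arg\max$ are broken by any measurable rule. A sample is one time step of interaction; every episode is charged its full length $H+K-1$. **Theorem.** There are universal constants $C>0$ and $q\in\mathbb N$ such that for all $H,K,d\ge 1$, $A\ge 2$, $\Theta\ge 1$, $0<\Delta\le\Theta$ and $0<\delta\le\frac12$ there are $\lambda,\varepsilon>0$ and $M\ge1$, depending only on these numbers, for which the following holds for every POMDP, features and tie-breaking rule as above. With probability at least $1-\delta$ the algorithm stops, returns an optimal action sequence $a^\star_{0:H-1}$ (one whose execution maximizes $\mathbb E_\pi[\sum_{h<H}r_h]$ over all history-dependent policies $\pi$), and has used at most $$C\,\log^q\!\Big(2+H+dA^{K}+\Theta+\tfrac1\Delta+\ln\tfrac1\delta\Big)\;H^5\,\Theta^5A^{3K-1}d^2\,\Delta^{-5}\ln(1/\delta)$$ samples. (If some gap is positive, then $\Delta\le\Theta$ holds automatically;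 $\Theta\ge1$ can always be achieved by enlarging $W$.) -/

import Mathlib

open MeasureTheory ProbabilityTheory
open scoped BigOperators Matrix

namespace HSEPOMDP

/-! ## Partially observable Markov decision processes

The horizon `H` is a separate parameter: only the rewards of the steps `h < H` count.  All families
are indexed by every `h : ℕ`, because a window of `K` observations that starts at a step `h < H` may
end after step `H - 1`.  The action set is `Fin A`. -/

/-- An episodic POMDP with state space `S`, observation space `O`, action set `Fin A`, transition
kernels `trans h a`, emission kernels `emit h`, reward kernels `rew h a` with rewards in `[0, 1]`,
and a fixed initial state. -/
structure POMDP (S O : Type*) [MeasurableSpace S] [MeasurableSpace O] (A : ℕ) where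
  trans : ℕ → Fin A → Kernel S S
  emit : ℕ → Kernel S O
  rew : ℕ → Fin A → Kernel S ℝ
  init : S
  trans_markov : ∀ h a, IsMarkovKernel (trans h a)
  emit_markov : ∀ h, IsMarkovKernel (emit h)
  rew_markov : ∀ h a, IsMarkovKernel (rew h a)
  rew_mem : ∀ h a s, ∀ᵐ r ∂(rew h a s), r ∈ Set.Icc (0 : ℝ) 1

attribute [instance] POMDP.trans_markov POMDP.emit_markov POMDP.rew_markov

namespace POMDP

variable {S O : Type*} [MeasurableSpace S] [MeasurableSpace O] {A : ℕ}

/-- The law of `((o_h, r_h), …, (o_{h+n-1}, r_{h+n-1}))`, as a kernel in the state `s_h`, when the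
actions `a 0, …, a (n-1)` are executed at the steps `h, …, h+n-1`. -/
noncomputable def episode (P : POMDP S O A) :
    (n : ℕ) → (h : ℕ) → (Fin n → Fin A) → Kernel S (Fin n → O × ℝ)
  | 0, _, _ => Kernel.const S (Measure.dirac Fin.elim0)
  | n + 1, h, a =>
    ((P.emit h ×ₖ P.rew h (a 0)) ×ₖ
      (episode P n (h + 1) (fun i => a i.succ) ∘ₖ P.trans h (a 0))).map
      (fun x => (Fin.cons x.1 x.2 : Fin (n + 1) → O × ℝ))

/-- The law of `(o_h, …, o_{h+n})`, as a kernel in the state `s_h`, when the actions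
`b 0, …, b (n-1)` are executed at the steps `h, …, h+n-1`. -/
noncomputable def window (P : POMDP S O A) :
    (n : ℕ) → (h : ℕ) → (Fin n → Fin A) → Kernel S (Fin (n + 1) → O)
  | 0, h, _ => (P.emit h).map (fun o => fun _ => o)
  | n + 1, h, b =>
    (P.emit h ×ₖ (window P n (h + 1) (fun i => b i.succ) ∘ₖ P.trans h (b 0))).map
      (fun x => (Fin.cons x.1 x.2 : Fin (n + 2) → O))

theorem measurable_cons {X : Type*} [MeasurableSpace X] (n : ℕ) :
    Measurable (fun x : X × (Fin n → X) => (Fin.cons x.1 x.2 : Fin (n + 1) → X)) := by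
  refine measurable_pi_lambda _ (fun i => ?_)
  refine Fin.cases ?_ (fun j => ?_) i
  · simpa using measurable_fst
  · simpa [Function.comp_def] using (measurable_pi_apply j).comp measurable_snd

instance episode_markov (P : POMDP S O A) (n h : ℕ) (a : Fin n → Fin A) :
    IsMarkovKernel (P.episode n h a) := by
  induction n generalizing h with
  | zero => unfold episode; infer_instance
  | succ n ih =>
    unfold episode
    have := ih (h + 1) (fun i => a i.succ)
    exact Kernel.IsMarkovKernel.map _ (measurable_cons n)

instance window_markov (P : POMDP S O A) (n h : ℕ) (b : Fin n → Fin A) :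
    IsMarkovKernel (P.window n h b) := by
  induction n generalizing h with
  | zero =>
    unfold window
    exact Kernel.IsMarkovKernel.map _ (measurable_pi_lambda _ (fun _ => measurable_id))
  | succ n ih =>
    unfold window
    have := ih (h + 1) (fun i => b i.succ)
    exact Kernel.IsMarkovKernel.map _ (measurable_cons (n + 1))

/-- The mean reward `r_h(s, a)`. -/
noncomputable def meanRew (P : POMDP S O A) (h : ℕ) (s : S) (a : Fin A) : ℝ :=
  ∫ r, r ∂(P.rew h a s)

/-- The transitions are deterministic, given by the maps `p h`. -/
def IsDeterministic (P : POMDP S O A) (p : ℕ → S → Fin A → S) : Prop :=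
  ∀ h a s, P.trans h a s = Measure.dirac (p h s a)

/-- `qStep P p n h` is the optimal `Q`-function at step `h` when `n` steps remain. -/
noncomputable def qStep (P : POMDP S O A) (p : ℕ → S → Fin A → S) : ℕ → ℕ → S → Fin A → ℝ
  | 0, _, _, _ => 0
  | n + 1, h, s, a => P.meanRew h s a + ⨆ a' : Fin A, qStep P p n (h + 1) (p h s a) a'

/-- The optimal `Q`-function: `Q_H = 0` and `Q_h(s,a) = r_h(s,a) + max_{a'} Q_{h+1}(p_h(s,a), a')`
for `h < H`. -/
noncomputable def qStar (P : POMDP S O A) (p : ℕ → S → Fin A → S) (H h : ℕ) (s : S)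
    (a : Fin A) : ℝ :=
  qStep P p (H - h) h s a

/-- `V_h(s) = max_a Q_h(s,a)`. -/
noncomputable def vStar (P : POMDP S O A) (p : ℕ → S → Fin A → S) (H h : ℕ) (s : S) : ℝ :=
  ⨆ a : Fin A, qStar P p H h s a

/-- `gap_h(s,a) = V_h(s) - Q_h(s,a)`. -/
noncomputable def gap (P : POMDP S O A) (p : ℕ → S → Fin A → S) (H h : ℕ) (s : S)
    (a : Fin A) : ℝ :=
  vStar P p H h s - qStar P p H h s a

/-- A history-dependent policy: it picks an action from the past observations, actions and rewards
and the current observation. The current step is the length of the history. -/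
abbrev Policy (O : Type*) (A : ℕ) := List (O × Fin A × ℝ) → O → Fin A

/-- The expected sum of the rewards of the next `n` steps under the policy `π`, from step `h` with
history `l` in the latent state `s`. -/
noncomputable def valueFrom (P : POMDP S O A) (π : Policy O A) :
    ℕ → ℕ → List (O × Fin A × ℝ) → S → ℝ
  | 0, _, _, _ => 0
  | n + 1, h, l, s =>
    ∫ o, ∫ r, (r + ∫ s', valueFrom P π n (h + 1) (l ++ [(o, π l o, r)]) s'
      ∂(P.trans h (π l o) s)) ∂(P.rew h (π l o) s) ∂(P.emit h s)

/-- The value `E_π[∑_{h < H} r_h]` of a policy. -/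
noncomputable def value (P : POMDP S O A) (H : ℕ) (π : Policy O A) : ℝ :=
  P.valueFrom π H 0 [] P.init

/-- The policy that executes the actions of the list `l` in turn. -/
def openLoop (O : Type*) [NeZero A] (l : List (Fin A)) : Policy O A :=
  fun hist _ => l.getD hist.length 0

/-- `l` is an optimal action sequence `a_0, …, a_{H-1}`: executing it is optimal among all
policies. -/
def IsOptimalActions [NeZero A] (P : POMDP S O A) (H : ℕ) (l : List (Fin A)) : Prop :=
  l.length = H ∧ ∀ π : Policy O A, P.value H π ≤ P.value H (openLoop O l)

end POMDP

/-- The smallest singular value of a matrix. -/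
noncomputable def smallestSingularValue {d ds : ℕ} (G : Matrix (Fin d) (Fin ds) ℝ) : ℝ :=
  (Matrix.toEuclideanLin G).singularValues (min d ds - 1)

/-! ## Running an algorithm against the POMDP

With `k = K - 1`, an episode consists of the `H + k` steps `0, …, H + k - 1`; this is long enough
for a window of `K` observations that starts at any step `h < H`. -/

/-- The actions of one episode. -/
abbrev Plan (H k A : ℕ) := Fin (H + k) → Fin A

/-- The observations and the rewards of one episode. -/
abbrev Outcome (H k : ℕ) (O : Type*) := Fin (H + k) → O × ℝ

/-- `ω (n, a)` is the outcome of the `n`-th episode if the plan `a` is executed in it. An algorithm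
reads one entry for each `n`. -/
abbrev Tape (H k A : ℕ) (O : Type*) := ℕ × Plan H k A → Outcome H k O

/-- The law of the tape: independent episodes, each started in the initial state. -/
noncomputable def tapeLaw {S O : Type*} [MeasurableSpace S] [MeasurableSpace O] {A : ℕ}
    (P : POMDP S O A) (H k : ℕ) : Measure (Tape H k A O) :=
  Measure.infinitePi (fun i : ℕ × Plan H k A => P.episode (H + k) 0 i.2 P.init)

instance tapeLaw_probability {S O : Type*} [MeasurableSpace S] [MeasurableSpace O] {A : ℕ}
    (P : POMDP S O A) (H k : ℕ) : IsProbabilityMeasure (tapeLaw P H k) := by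
  unfold tapeLaw; infer_instance

/-! ## The algorithm -/

/-- Stacked features: one block of dimension `d` for each sequence of `k` actions. -/
abbrev Feat (k A d : ℕ) := (Fin k → Fin A) × Fin d → ℝ

/-- A level data set: pairs of an estimated feature `x̂` and the values `(y_a)_a`. The list stands for
`D_h` (the first components) and for all `D_{a;h}` (the pairs `(x̂, y_a)`). -/
abbrev Dataset (k A d : ℕ) := List (Feat k A d × (Fin A → ℝ))

/-- `Σ(D) = ∑_j x̂_j x̂_jᵀ + λ I`. -/
noncomputable def sigmaMat {k A d : ℕ} (lam : ℝ) (D : Dataset k A d) :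
    Matrix ((Fin k → Fin A) × Fin d) ((Fin k → Fin A) × Fin d) ℝ :=
  (D.map (fun e => Matrix.vecMulVec e.1 e.1)).sum + lam • 1

/-- `θ̂_a(D) = Σ(D)⁻¹ ∑_j y_{a,j} x̂_j`. -/
noncomputable def thetaHat {k A d : ℕ} (lam : ℝ) (D : Dataset k A d) (a : Fin A) : Feat k A d :=
  (sigmaMat lam D)⁻¹ *ᵥ (D.map (fun e => e.2 a • e.1)).sum

/-- `‖x‖_{Σ(D)⁻¹}`. -/
noncomputable def sigmaInvNorm {k A d : ℕ} (lam : ℝ) (D : Dataset k A d) (x : Feat k A d) : ℝ :=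
  Real.sqrt (x ⬝ᵥ ((sigmaMat lam D)⁻¹ *ᵥ x))

/-- The state of the algorithm: the number of episodes executed so far and the data sets. -/
structure AlgState (H k A d : ℕ) where
  episodes : ℕ
  data : Fin H → Dataset k A d

/-- The inputs of the algorithm: the parameters `λ`, `ε`, `M`, the feature `ψ` of windows of `k + 1`
observations, and the rule `amax` that selects a maximizer. -/
structure AlgInput (k A d : ℕ) (O : Type*) where
  lam : ℝ
  eps : ℝ
  M : ℕ
  ψ : (Fin (k + 1) → O) → EuclideanSpace ℝ (Fin d)
  amax : (Fin A → ℝ) → Fin A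

section Algorithm

variable {H k A d : ℕ} [NeZero A] {O : Type*} (I : AlgInput k A d O) (ω : Tape H k A O)

/-- Execute the actions of `l`, then an arbitrary fixed action until the episode ends. -/
def planOf (H k : ℕ) (l : List (Fin A)) : Plan H k A := fun t => l.getD t 0

/-- The observations `o_h, …, o_{h+k}` of an episode. -/
def obsWindow (h : Fin H) (x : Outcome H k O) : Fin (k + 1) → O :=
  fun i => (x ⟨h + i, by omega⟩).1

/-- The reward `r_h` of an episode. -/
def rewardAt (h : Fin H) (x : Outcome H k O) : ℝ :=
  (x ⟨h, by omega⟩).2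

/-- The estimated stacked feature after the actions `l = a_{0:h-1}`: for each sequence `b` of `k`
actions, the mean of `ψ(o_{h:h+k})` over `M` fresh episodes that execute `l` and then `b`. It uses
the `M * A ^ k` episodes `n, …, n + M * A ^ k - 1`. -/
noncomputable def featEst (h : Fin H) (l : List (Fin A)) (n : ℕ) : Feat k A d :=
  fun bj => (∑ i : Fin I.M, I.ψ (obsWindow h
    (ω (n + I.M * (finFunctionFinEquiv bj.1 : Fin (A ^ k)) + i,
      planOf H k (l ++ List.ofFn bj.1)))) bj.2) / I.M

/-- The mean of the reward `r_h` over `M` fresh episodes `n, …, n + M - 1` that execute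
`l = a_{0:h}`. -/
noncomputable def rewEst (h : Fin H) (l : List (Fin A)) (n : ℕ) : ℝ :=
  (∑ i : Fin I.M, rewardAt h (ω (n + i, planOf H k l))) / I.M

/-- The step taken when the feature `x` after `l = a_{0:h-1}` is not covered by the data: for each
action `a'` in turn, estimate the reward, add the value returned by `next` after `l, a'` to get
`y_{a'}`; finally add `(x, y)` to the data of level `h`. -/
noncomputable def explore (h : Fin H) (l : List (Fin A)) (x : Feat k A d)
    (next : List (Fin A) → AlgState H k A d → ℝ × AlgState H k A d) (st : AlgState H k A d) :
    (Fin A → ℝ) × AlgState H k A d :=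
  let res := (List.finRange A).foldl
    (fun (acc : (Fin A → ℝ) × AlgState H k A d) a' =>
      let r := rewEst I ω h (l ++ [a']) acc.2.episodes
      let out := next (l ++ [a']) { acc.2 with episodes := acc.2.episodes + I.M }
      (Function.update acc.1 a' (r + out.1), out.2))
    ((fun _ => 0), st)
  (res.1, { res.2 with data := Function.update res.2.data h (res.2.data h ++ [(x, res.1)]) })

/-- The subroutine Compute-`V` at step `h`, after the actions `l = a_{0:h-1}`, with `r = H - h` steps
remaining; it returns `0` at `h = H`. -/
noncomputable def computeV : (r h : ℕ) → h + r = H → List (Fin A) → AlgState H k A d →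
    ℝ × AlgState H k A d
  | 0, _, _, _, st => (0, st)
  | 1, h, hr, l, st =>
    (⨆ a' : Fin A, rewEst I ω ⟨h, by omega⟩ (l ++ [a']) (st.episodes + I.M * a'),
      { st with episodes := st.episodes + I.M * A })
  | r + 2, h, hr, l, st =>
    let hh : Fin H := ⟨h, by omega⟩
    let x := featEst I ω hh l st.episodes
    let st₁ : AlgState H k A d := { st with episodes := st.episodes + I.M * A ^ k }
    if sigmaInvNorm I.lam (st₁.data hh) x ≤ I.eps then
      let a := I.amax (fun a => thetaHat I.lam (st₁.data hh) a ⬝ᵥ x)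
      let rhat := rewEst I ω hh (l ++ [a]) st₁.episodes
      let out := computeV (r + 1) (h + 1) (by omega) (l ++ [a])
        { st₁ with episodes := st₁.episodes + I.M }
      (rhat + out.1, out.2)
    else
      let out := explore I ω hh l x
        (fun l' st' => computeV (r + 1) (h + 1) (by omega) l' st') st₁
      (⨆ a : Fin A, out.1 a, out.2)

/-- The loop over the levels `h, …, H - 1` of the main routine, with `r = H - h` levels to go: it
estimates the feature after `l = a_{0:h-1}` and appends the greedy action `a_h`. The first level
whose feature is not covered by the data is recorded, with its actions and its feature. -/
noncomputable def rollout : (r h : ℕ) → h + r = H → List (Fin A) →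
    Option (Fin H × List (Fin A) × Feat k A d) → AlgState H k A d →
    Option (Fin H × List (Fin A) × Feat k A d) × List (Fin A) × AlgState H k A d
  | 0, _, _, l, bad, st => (bad, l, st)
  | r + 1, h, hr, l, bad, st =>
    let hh : Fin H := ⟨h, by omega⟩
    let x := featEst I ω hh l st.episodes
    let a := I.amax (fun a => thetaHat I.lam (st.data hh) a ⬝ᵥ x)
    let bad' := if bad = none ∧ ¬ sigmaInvNorm I.lam (st.data hh) x ≤ I.eps
      then some (hh, l, x) else bad
    rollout r (h + 1) (by omega) (l ++ [a]) bad'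
      { st with episodes := st.episodes + I.M * A ^ k }

/-- The main loop, run for at most `n` iterations: the returned action sequence and the final
state, or `none` if the loop has not stopped by then. -/
noncomputable def mainLoop : ℕ → AlgState H k A d → Option (List (Fin A) × AlgState H k A d)
  | 0, _ => none
  | n + 1, st =>
    match rollout I ω H 0 (Nat.zero_add H) [] none st with
    | (none, l, st') => some (l, st')
    | (some (h, l, x), _, st') =>
      mainLoop n (explore I ω h l x
        (fun l' st'' => computeV I ω (H - (h + 1)) (h + 1) (by omega) l' st'') st').2

/-- On the tape `ω` the algorithm, started with empty data sets, stops and returns the actions `l`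
after `N` samples. Every episode is charged its `H + k = H + K - 1` steps. -/
def Outputs (l : List (Fin A)) (N : ℕ) : Prop :=
  ∃ (n : ℕ) (st : AlgState H k A d),
    mainLoop I ω n { episodes := 0, data := fun _ => [] } = some (l, st) ∧
    N = st.episodes * (H + k)

end Algorithm

end HSEPOMDP

namespace HSEPOMDP

/-! ## Linear algebra -/

/-! Left-invertibility of `G h` turns the linear form of `Q*` in the unknown state feature into a
linear form in the expected future feature, with a vector `θ` of norm at most `Θ`
(`exists_inner_toEuclideanLin_eq`). The stacked feature has a block for every sequence `b`. Placing
`θ` in the block of the unknown good sequence makes `Q*` a bounded linear functional of the stacked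
feature, and the algorithm never has to know which block it is.

Three facts then interlock. (1) If the regression targets have error at most `2 * e`, the ridge
prediction at a covered feature is off by less than `Δ / 2`, so by the gap the greedy action is
exactly optimal (`GoodTape.favorable`). (2) Because greedy actions are exact, errors do not compound
over levels: a computed value differs from `V*` only through deviations of reward estimates summed
along a path, and a maximum over explored actions is caught between two such sums
(`Sandwiched.iSup`). Hence targets of all levels have the same accuracy, which is what (1) needs.
(3) Uncovered features are few: with `ε = 1` each at least doubles the determinant of `Σ`, so a data
set holds `O(D L)` entries, with `D = A ^ k * d` and `L` the logarithmic factor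
(`Uncovered.pow_le`). Every exploration adds an entry that pays for it, and this bounds the number
of episodes by some `N` (`mainLoop_spec`).

Adaptivity is met by a union bound. The tape fixes the outcome of every episode under every plan,
and a good tape is accurate for all action sequences and all starting episodes below `N`
(`goodTape_compl`). The logarithm of the number of events is of order `H L`, and since `N` enters
only through its logarithm, `M` can be fixed before `N` is known. The argument yields `(Θ / Δ) ^ 2`,
weakened at the end to fifth powers. -/

theorem smallestSingularValue_mul_norm_le {d ds : ℕ} (hds : ds ≤ d)
    (G : Matrix (Fin d) (Fin ds) ℝ) (x : EuclideanSpace ℝ (Fin ds)) :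
    smallestSingularValue G * ‖x‖ ≤ ‖Matrix.toEuclideanLin G x‖ := by
  set T := Matrix.toEuclideanLin G with hT
  have hn : Module.finrank ℝ (EuclideanSpace ℝ (Fin ds)) = ds := by simp
  have hS := T.isSymmetric_adjoint_comp_self
  set b := hS.eigenvectorBasis hn
  have hnn : 0 ≤ smallestSingularValue G := T.singularValues_nonneg _
  refine le_of_sq_le_sq ?_ (norm_nonneg _)
  have h1 : ‖T x‖ ^ 2 = ∑ i, hS.eigenvalues hn i * (inner ℝ (b i) x) ^ 2 := by
    rw [← real_inner_self_eq_norm_sq, ← LinearMap.adjoint_inner_right, real_inner_comm,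
      ← b.sum_inner_mul_inner]
    refine Finset.sum_congr rfl fun i _ => ?_
    have h2 : inner ℝ ((LinearMap.adjoint T) (T x)) (b i)
        = hS.eigenvalues hn i * inner ℝ (b i) x := by
      have h3 := hS x (b i)
      rw [LinearMap.comp_apply] at h3
      rw [h3, hS.apply_eigenvectorBasis hn i, inner_smul_right, real_inner_comm]
      rfl
    rw [h2]; ring
  have h2 : ‖x‖ ^ 2 = ∑ i, (inner ℝ (b i) x) ^ 2 := by
    rw [← real_inner_self_eq_norm_sq, ← b.sum_inner_mul_inner]
    refine Finset.sum_congr rfl fun i _ => ?_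
    rw [real_inner_comm]; ring
  rw [mul_pow, h1, h2, Finset.mul_sum]
  refine Finset.sum_le_sum fun i _ => mul_le_mul_of_nonneg_right ?_ (sq_nonneg _)
  rw [← T.sq_singularValues_fin hn i]
  refine pow_le_pow_left₀ hnn ?_ 2
  -- As `ds ≤ d`, the index `min d ds - 1` is that of the last, hence smallest, of the `ds` singular
  -- values.
  refine T.singularValues_antitone ?_
  have := i.2
  omega

/-- `Lᵀ w` pairs with `G x` to `⟨w, x⟩`, but its norm is not controlled by `σ`. Its projection onto
the range of `G` gives the same pairings and equals some `G x`, so `‖G x‖² = ⟨w, x⟩ ≤ W ‖x‖ ≤ W ‖G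
x‖ / σ`. -/
theorem exists_inner_toEuclideanLin_eq {d ds : ℕ} (G : Matrix (Fin d) (Fin ds) ℝ)
    (L : Matrix (Fin ds) (Fin d) ℝ) (hL : L * G = 1) {W σ : ℝ} (hσ : 0 < σ)
    (hσG : σ ≤ smallestSingularValue G) (w : EuclideanSpace ℝ (Fin ds)) (hw : ‖w‖ ≤ W) :
    ∃ θ : EuclideanSpace ℝ (Fin d), ‖θ‖ ≤ W / σ ∧
      ∀ x, inner ℝ θ (Matrix.toEuclideanLin G x) = inner ℝ w x := by
  have hLG : ∀ x, Matrix.toEuclideanLin L (Matrix.toEuclideanLin G x) = x := by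
    intro x
    ext i
    simp [Matrix.toLpLin_apply, Matrix.mulVec_mulVec, hL]
  have hds : ds ≤ d := by
    have hinj : Function.Injective (Matrix.toEuclideanLin G) :=
      Function.LeftInverse.injective hLG
    simpa using LinearMap.finrank_le_finrank_of_injective hinj
  set R := LinearMap.range (Matrix.toEuclideanLin G)
  set u := LinearMap.adjoint (Matrix.toEuclideanLin L) w
  refine ⟨R.starProjection u, ?_, ?_⟩
  · obtain ⟨x, hx⟩ : R.starProjection u ∈ R := R.starProjection_apply_mem u
    have h1 : inner ℝ (R.starProjection u) (R.starProjection u) = inner ℝ w x := by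
      conv_lhs => rw [Submodule.inner_starProjection_left_eq_right,
        Submodule.starProjection_eq_self_iff.2 (R.starProjection_apply_mem u), ← hx]
      rw [LinearMap.adjoint_inner_left, hLG]
    have h2 : σ * ‖x‖ ≤ ‖R.starProjection u‖ := by
      rw [← hx]
      exact (mul_le_mul_of_nonneg_right hσG (norm_nonneg _)).trans
        (smallestSingularValue_mul_norm_le hds G x)
    rw [real_inner_self_eq_norm_sq] at h1
    have h3 : inner ℝ w x ≤ W * ‖x‖ :=
      (real_inner_le_norm w x).trans (mul_le_mul_of_nonneg_right hw (norm_nonneg _))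
    rw [le_div_iff₀ hσ]
    have hW : 0 ≤ W := (norm_nonneg _).trans hw
    rcases (norm_nonneg (R.starProjection u)).eq_or_lt with h0 | h0
    · rw [← h0]; simpa using hW
    · have : ‖R.starProjection u‖ * (‖R.starProjection u‖ * σ) ≤ ‖R.starProjection u‖ * W := by
        nlinarith
      exact le_of_mul_le_mul_left this h0
  · intro x
    rw [Submodule.inner_starProjection_left_eq_right,
      Submodule.starProjection_eq_self_iff.2 (LinearMap.mem_range_self _ x),
      LinearMap.adjoint_inner_left, hLG]

/-! ### Ridge regression and the elliptical potential. -/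

section Ridge

variable {k A d : ℕ}

theorem sigmaMat_append (lam : ℝ) (D : Dataset k A d) (e : Feat k A d × (Fin A → ℝ)) :
    sigmaMat lam (D ++ [e]) = sigmaMat lam D + Matrix.vecMulVec e.1 e.1 := by
  simp only [sigmaMat, List.map_append, List.sum_append, List.map_cons, List.map_nil,
    List.sum_singleton]
  abel

theorem dotProduct_sigmaMat_mulVec (lam : ℝ) (D : Dataset k A d) (z v : Feat k A d) :
    z ⬝ᵥ (sigmaMat lam D *ᵥ v)
      = (D.map (fun e => (z ⬝ᵥ e.1) * (v ⬝ᵥ e.1))).sum + lam * (z ⬝ᵥ v) := by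
  unfold sigmaMat
  induction D with
  | nil => simp [Matrix.smul_mulVec]
  | cons e D ih =>
    simp only [List.map_cons, List.sum_cons]
    rw [add_assoc, Matrix.add_mulVec, dotProduct_add, ih, Matrix.vecMulVec_mulVec, add_assoc]
    congr 1
    simp [dotProduct_smul, dotProduct_comm v, mul_comm]

theorem sigmaMat_posDef {lam : ℝ} (hlam : 0 < lam) (D : Dataset k A d) :
    (sigmaMat lam D).PosDef := by
  induction D using List.reverseRecOn with
  | nil =>
    simp only [sigmaMat, List.map_nil, List.sum_nil, zero_add]
    exact Matrix.PosDef.one.smul hlam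
  | append_singleton D e ih =>
    rw [sigmaMat_append]
    exact ih.add_posSemidef (by simpa using Matrix.posSemidef_vecMulVec_self_star e.1)

theorem sigmaMat_inv_mulVec {lam : ℝ} (hlam : 0 < lam) (D : Dataset k A d) (v : Feat k A d) :
    sigmaMat lam D *ᵥ ((sigmaMat lam D)⁻¹ *ᵥ v) = v := by
  have := (sigmaMat_posDef hlam D).isUnit
  rw [Matrix.mulVec_mulVec, Matrix.mul_nonsing_inv _ ((Matrix.isUnit_iff_isUnit_det _).1 this),
    Matrix.one_mulVec]

theorem sigmaMat_dotProduct_comm (lam : ℝ) (D : Dataset k A d) (z v : Feat k A d) :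
    z ⬝ᵥ (sigmaMat lam D *ᵥ v) = (sigmaMat lam D *ᵥ z) ⬝ᵥ v := by
  rw [dotProduct_comm (sigmaMat lam D *ᵥ z), dotProduct_sigmaMat_mulVec,
    dotProduct_sigmaMat_mulVec, dotProduct_comm z v]
  simp only [mul_comm]

/-- Cauchy–Schwarz with a uniform bound on `f`. The factor `√D.length` is the price for assuming no
independence of the errors, so adaptively produced targets are harmless. -/
theorem abs_list_sum_mul_le {ι : Type*} (D : List ι) (f g : ι → ℝ) {e : ℝ} (he : 0 ≤ e)
    (hf : ∀ i ∈ D, |f i| ≤ e) :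
    |(D.map (fun i => f i * g i)).sum| ≤ √D.length * e * √((D.map (fun i => g i * g i)).sum) := by
  have h1 : |(D.map (fun i => f i * g i)).sum| ≤ e * (D.map (fun i => |g i|)).sum := by
    induction D with
    | nil => simp
    | cons i D ih =>
      simp only [List.map_cons, List.sum_cons, mul_add]
      refine (abs_add_le _ _).trans
        (add_le_add ?_ (ih fun j hj => hf j (List.mem_cons_of_mem _ hj)))
      rw [abs_mul]
      exact mul_le_mul_of_nonneg_right (hf i List.mem_cons_self) (abs_nonneg _)
  have h2 : (D.map (fun i => |g i|)).sum ≤ √D.length * √((D.map (fun i => g i * g i)).sum) := by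
    rw [← Real.sqrt_mul (Nat.cast_nonneg _)]
    refine Real.le_sqrt_of_sq_le ?_
    have h3 := sq_sum_le_card_mul_sum_sq (s := Finset.univ)
      (f := fun i : Fin D.length => |g D[i.1]|)
    rw [Fin.sum_univ_fun_getElem D (fun i => |g i|)] at h3
    simp only [Finset.card_univ, Fintype.card_fin, sq_abs, pow_two (g _)] at h3
    rwa [Fin.sum_univ_fun_getElem D (fun i => g i * g i)] at h3
  nlinarith [mul_le_mul_of_nonneg_left h2 he]

theorem list_sum_dotProduct {ι : Type*} [Fintype ι] {β : Type*} (D : List β) (f : β → ι → ℝ)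
    (z : ι → ℝ) : (D.map f).sum ⬝ᵥ z = (D.map (fun c => f c ⬝ᵥ z)).sum := by
  induction D with
  | nil => simp
  | cons c D ih => simp [add_dotProduct, ih]

theorem list_sum_map_sub {β : Type*} (D : List β) (f g : β → ℝ) :
    (D.map (fun c => f c - g c)).sum = (D.map f).sum - (D.map g).sum := by
  induction D with
  | nil => simp
  | cons c D ih => simp only [List.map_cons, List.sum_cons, ih]; ring

theorem dotProduct_self_nonneg' {ι : Type*} [Fintype ι] (z : ι → ℝ) : 0 ≤ z ⬝ᵥ z :=
  Finset.sum_nonneg fun _ _ => mul_self_nonneg _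

theorem abs_dotProduct_le {ι : Type*} [Fintype ι] (θ z : ι → ℝ) :
    |θ ⬝ᵥ z| ≤ √(θ ⬝ᵥ θ) * √(z ⬝ᵥ z) := by
  rw [← Real.sqrt_mul (dotProduct_self_nonneg' θ)]
  refine Real.abs_le_sqrt ?_
  simpa [dotProduct, pow_two] using Finset.sum_mul_sq_le_sq_mul_sq Finset.univ θ z

/-- The prediction error of ridge regression on data with errors at most `e`. -/
theorem thetaHat_error {lam : ℝ} (hlam : 0 < lam) (D : Dataset k A d) (a : Fin A)
    (x θ : Feat k A d) {e B : ℝ} (he : 0 ≤ e) (hB : 0 ≤ B) (hθ : θ ⬝ᵥ θ ≤ B ^ 2)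
    (hD : ∀ c ∈ D, |c.2 a - θ ⬝ᵥ c.1| ≤ e) :
    |thetaHat lam D a ⬝ᵥ x - θ ⬝ᵥ x|
      ≤ sigmaInvNorm lam D x * (√D.length * e + √lam * B) := by
  -- With this dual vector the error is `∑ (y_j - θ·x_j)(z·x_j) - λ θ·z`, while `‖x‖²_{Σ⁻¹} = ∑
  -- (z·x_j)² + λ ‖z‖²` controls both terms.
  set z := (sigmaMat lam D)⁻¹ *ᵥ x with hz
  have hx : sigmaMat lam D *ᵥ z = x := sigmaMat_inv_mulVec hlam D x
  set Q := (D.map (fun c => (z ⬝ᵥ c.1) * (z ⬝ᵥ c.1))).sum with hQ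
  have hQ0 : 0 ≤ Q := List.sum_nonneg (by
    intro r hr
    obtain ⟨c, _, rfl⟩ := List.mem_map.1 hr
    exact mul_self_nonneg _)
  have hs : sigmaInvNorm lam D x = √(Q + lam * (z ⬝ᵥ z)) := by
    rw [sigmaInvNorm, ← hz, dotProduct_comm, hQ, ← dotProduct_sigmaMat_mulVec, hx]
  have hzz := dotProduct_self_nonneg' z
  have hQs : √Q ≤ sigmaInvNorm lam D x := by
    rw [hs]; exact Real.sqrt_le_sqrt (le_add_of_nonneg_right (by positivity))
  have hzs : √lam * √(z ⬝ᵥ z) ≤ sigmaInvNorm lam D x := by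
    rw [hs, ← Real.sqrt_mul hlam.le]; exact Real.sqrt_le_sqrt (le_add_of_nonneg_left hQ0)
  have h1 : thetaHat lam D a ⬝ᵥ x = (D.map (fun c => c.2 a * (z ⬝ᵥ c.1))).sum := by
    conv_lhs => rw [← hx, sigmaMat_dotProduct_comm, thetaHat, sigmaMat_inv_mulVec hlam,
      list_sum_dotProduct]
    simp only [smul_dotProduct, smul_eq_mul, dotProduct_comm z]
  have h2 : θ ⬝ᵥ x = (D.map (fun c => (θ ⬝ᵥ c.1) * (z ⬝ᵥ c.1))).sum + lam * (θ ⬝ᵥ z) := by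
    conv_lhs => rw [← hx, dotProduct_sigmaMat_mulVec]
  have h3 : thetaHat lam D a ⬝ᵥ x - θ ⬝ᵥ x
      = (D.map (fun c => (c.2 a - θ ⬝ᵥ c.1) * (z ⬝ᵥ c.1))).sum - lam * (θ ⬝ᵥ z) := by
    simp only [sub_mul]
    rw [h1, h2, list_sum_map_sub]
    ring
  rw [h3]
  refine (abs_sub _ _).trans ?_
  have h4 := abs_list_sum_mul_le D (fun c => c.2 a - θ ⬝ᵥ c.1) (fun c => z ⬝ᵥ c.1) he hD
  have h5 : |lam * (θ ⬝ᵥ z)| ≤ √lam * B * sigmaInvNorm lam D x := by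
    rw [abs_mul, abs_of_pos hlam]
    have h6 : √(θ ⬝ᵥ θ) ≤ B := Real.sqrt_le_iff.2 ⟨hB, hθ⟩
    calc lam * |θ ⬝ᵥ z| ≤ lam * (B * √(z ⬝ᵥ z)) := by
          gcongr
          exact (abs_dotProduct_le θ z).trans (by gcongr)
      _ = √lam * B * (√lam * √(z ⬝ᵥ z)) := by
          nth_rewrite 1 [← Real.mul_self_sqrt hlam.le]; ring
      _ ≤ _ := by gcongr
  have h7 : √D.length * e * √Q ≤ √D.length * e * sigmaInvNorm lam D x := by gcongr
  rw [← hQ] at h4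
  linarith

/-- Every feature of the list has squared norm at most `R` and is not covered by its
predecessors. -/
inductive Uncovered (lam eps R : ℝ) : Dataset k A d → Prop
  | nil : Uncovered lam eps R []
  | append (D : Dataset k A d) (x : Feat k A d) (y : Fin A → ℝ) : Uncovered lam eps R D →
      x ⬝ᵥ x ≤ R → ¬ sigmaInvNorm lam D x ≤ eps → Uncovered lam eps R (D ++ [(x, y)])

/-- Matrix determinant lemma: adding `x xᵀ` multiplies the determinant by `1 + ‖x‖²_{Σ⁻¹}`, which
exceeds `1 + eps ^ 2` when `x` is uncovered. -/
theorem Uncovered.det_ge {lam eps R : ℝ} (hlam : 0 < lam) (heps : 0 ≤ eps) {D : Dataset k A d}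
    (h : Uncovered lam eps R D) :
    lam ^ (A ^ k * d) * (1 + eps ^ 2) ^ D.length ≤ (sigmaMat lam D).det := by
  induction h with
  | nil => simp [sigmaMat]
  | append D x y _ _ hx ih =>
    have hpd := sigmaMat_posDef hlam D
    rw [sigmaMat_append, Matrix.vecMulVec_eq Unit, Matrix.det_add_replicateCol_mul_replicateRow
      ((Matrix.isUnit_iff_isUnit_det _).1 hpd.isUnit), List.length_append, List.length_singleton,
      pow_succ, ← mul_assoc]
    have h1 : eps ^ 2 ≤ x ⬝ᵥ ((sigmaMat lam D)⁻¹ *ᵥ x) := (Real.lt_sqrt heps).1 (not_le.1 hx) |>.le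
    have h2 : (1 + Matrix.replicateRow Unit x * (sigmaMat lam D)⁻¹ *
        Matrix.replicateCol Unit x).det = 1 + x ⬝ᵥ ((sigmaMat lam D)⁻¹ *ᵥ x) := by
      rw [Matrix.mul_assoc]
      simp [Matrix.mul_apply, Matrix.mulVec, dotProduct]
    simp only [h2]
    exact mul_le_mul ih (by linarith) (by positivity) hpd.det_pos.le

theorem Uncovered.quadForm_le {lam eps R : ℝ} {D : Dataset k A d}
    (h : Uncovered lam eps R D) (v : Feat k A d) :
    v ⬝ᵥ (sigmaMat lam D *ᵥ v) ≤ (lam + D.length * R) * (v ⬝ᵥ v) := by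
  induction h with
  | nil => simp [dotProduct_sigmaMat_mulVec]
  | append D x y _ hx _ ih =>
    rw [dotProduct_sigmaMat_mulVec] at ih ⊢
    simp only [List.map_append, List.sum_append, List.map_cons, List.map_nil, List.sum_singleton,
      List.length_append, List.length_singleton]
    push_cast
    have h1 : (v ⬝ᵥ x) * (v ⬝ᵥ x) ≤ (v ⬝ᵥ v) * (x ⬝ᵥ x) := by
      simpa [dotProduct, pow_two] using Finset.sum_mul_sq_le_sq_mul_sq Finset.univ v x
    nlinarith [mul_le_mul_of_nonneg_left hx (dotProduct_self_nonneg' v)]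

theorem det_le_pow {ι : Type*} [Fintype ι] [DecidableEq ι] {S : Matrix ι ι ℝ} (hS : S.PosDef)
    {c : ℝ} (hc : ∀ v : ι → ℝ, v ⬝ᵥ (S *ᵥ v) ≤ c * (v ⬝ᵥ v)) : S.det ≤ c ^ Fintype.card ι := by
  rw [hS.isHermitian.det_eq_prod_eigenvalues, ← Finset.card_univ]
  rw [← Finset.prod_const]
  refine Finset.prod_le_prod (fun i _ => (hS.eigenvalues_pos i).le) fun i _ => ?_
  have h1 := hS.isHermitian.mulVec_eigenvectorBasis i
  set b : ι → ℝ := ⇑(hS.isHermitian.eigenvectorBasis i) with hb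
  have h2 : b ⬝ᵥ b = 1 := by
    have h3 := hS.isHermitian.eigenvectorBasis.orthonormal.1 i
    have h4 := real_inner_self_eq_norm_sq (hS.isHermitian.eigenvectorBasis i)
    rw [h3, EuclideanSpace.inner_eq_star_dotProduct] at h4
    simpa using h4
  have h3 := hc b
  rw [h1, dotProduct_smul, h2] at h3
  simpa using h3

/-- The elliptical potential bound for an uncovered list. -/
theorem Uncovered.pow_le {lam eps R : ℝ} (hlam : 0 < lam) (heps : 0 ≤ eps) {D : Dataset k A d}
    (h : Uncovered lam eps R D) :
    (1 + eps ^ 2) ^ D.length ≤ (1 + D.length * R / lam) ^ (A ^ k * d) := by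
  have h1 := h.det_ge hlam heps
  have h2 := det_le_pow (sigmaMat_posDef hlam D) h.quadForm_le
  have h3 : lam + D.length * R = lam * (1 + D.length * R / lam) := by field_simp
  rw [h3, mul_pow] at h2
  simp only [Fintype.card_prod, Fintype.card_pi, Fintype.card_fin, Finset.prod_const,
    Finset.card_univ] at h2
  exact le_of_mul_le_mul_left (h1.trans h2) (by positivity)

end Ridge

/-! ## Value functions and marginals of the episode law -/

namespace POMDP

/-- The state reached from `s` at step `h` by executing the actions of a list. -/
def stateFrom {S : Type*} {A : ℕ} (p : ℕ → S → Fin A → S) : ℕ → S → List (Fin A) → S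
  | _, s, [] => s
  | h, s, a :: l => stateFrom p (h + 1) (p h s a) l

theorem stateFrom_append {S : Type*} {A : ℕ} (p : ℕ → S → Fin A → S) (h : ℕ) (s : S) (l : List (Fin A)) (a : Fin A) :
    stateFrom p h s (l ++ [a]) = p (h + l.length) (stateFrom p h s l) a := by
  induction l generalizing h s with
  | nil => rfl
  | cons b l ih =>
    simp only [List.cons_append, stateFrom, ih, List.length_cons]
    congr 1; omega

variable {S O : Type*} [MeasurableSpace S] [MeasurableSpace O] {A : ℕ}

/-- The sum of the mean rewards collected from `s` at step `h` by the actions of a list. -/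
noncomputable def pathMean (P : POMDP S O A) (p : ℕ → S → Fin A → S) :
    ℕ → S → List (Fin A) → ℝ
  | _, _, [] => 0
  | h, s, a :: l => P.meanRew h s a + pathMean P p (h + 1) (p h s a) l

theorem pathMean_append (P : POMDP S O A) (p : ℕ → S → Fin A → S) (h : ℕ) (s : S)
    (l : List (Fin A)) (a : Fin A) :
    P.pathMean p h s (l ++ [a])
      = P.pathMean p h s l + P.meanRew (h + l.length) (stateFrom p h s l) a := by
  induction l generalizing h s with
  | nil => simp [pathMean, stateFrom]
  | cons b l ih =>
    simp only [List.cons_append, pathMean, ih, stateFrom, List.length_cons]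
    rw [← add_assoc]
    congr 2; omega

theorem integrable_rew (P : POMDP S O A) (h : ℕ) (a : Fin A) (s : S) :
    Integrable (fun r : ℝ => r) (P.rew h a s) :=
  Integrable.of_mem_Icc 0 1 measurable_id.aemeasurable (P.rew_mem h a s)

theorem meanRew_nonneg (P : POMDP S O A) (h : ℕ) (s : S) (a : Fin A) : 0 ≤ P.meanRew h s a :=
  integral_nonneg_of_ae ((P.rew_mem h a s).mono fun _ hr => hr.1)

theorem integral_rew_add (P : POMDP S O A) (h : ℕ) (s : S) (a : Fin A) (c : ℝ) :
    ∫ r, (r + c) ∂(P.rew h a s) = P.meanRew h s a + c := by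
  rw [integral_add (P.integrable_rew h a s) (integrable_const c)]
  simp [meanRew]

/-! ### The Bellman bound for all policies and the value of an open-loop sequence. -/

section Values

variable (P : POMDP S O A) (p : ℕ → S → Fin A → S) (H : ℕ)

theorem qStep_nonneg (n h : ℕ) (s : S) (a : Fin A) : 0 ≤ P.qStep p n h s a := by
  induction n generalizing h s a with
  | zero => exact le_rfl
  | succ n ih => exact add_nonneg (P.meanRew_nonneg h s a) (Real.iSup_nonneg fun a' => ih _ _ a')

theorem vStar_nonneg (h : ℕ) (s : S) : 0 ≤ P.vStar p H h s :=
  Real.iSup_nonneg fun _ => P.qStep_nonneg p _ _ _ _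

theorem qStar_eq {h : ℕ} (hh : h < H) (s : S) (a : Fin A) :
    P.qStar p H h s a = P.meanRew h s a + P.vStar p H (h + 1) (p h s a) := by
  unfold vStar qStar
  obtain ⟨n, hn⟩ : ∃ n, H - h = n + 1 := ⟨H - h - 1, by omega⟩
  rw [hn, show H - (h + 1) = n by omega]
  rfl

theorem vStar_self (s : S) : P.vStar p H H s = 0 := by
  simp [vStar, qStar, qStep]

theorem qStar_le_vStar (h : ℕ) (s : S) (a : Fin A) : P.qStar p H h s a ≤ P.vStar p H h s :=
  le_ciSup (Set.finite_range _).bddAbove a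

theorem exists_qStar_eq_vStar [NeZero A] (h : ℕ) (s : S) :
    ∃ a, P.qStar p H h s a = P.vStar p H h s :=
  exists_eq_ciSup_of_finite

variable {P p}

/-- Policies are arbitrary functions, so `f` need not be measurable. Either it agrees at the atom
with a strongly measurable function, or the integral is `0` by convention and `0 ≤ c` suffices. -/
theorem integral_trans_le (hp : P.IsDeterministic p) (h : ℕ) (a : Fin A) (s : S) (f : S → ℝ)
    {c : ℝ} (hc : 0 ≤ c) (hf : f (p h s a) ≤ c) : ∫ s', f s' ∂(P.trans h a s) ≤ c := by
  rw [hp]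
  by_cases hfm : AEStronglyMeasurable f (Measure.dirac (p h s a))
  · obtain ⟨g, hg, hfg⟩ := hfm
    rw [integral_congr_ae hfg, integral_dirac' _ _ hg]
    -- Singletons of `S` need not be measurable; a measurable null superset of the disagreement set
    -- must miss the atom.
    obtain ⟨t, ht, htm, ht0⟩ := exists_measurable_superset_of_null (ae_iff.1 hfg)
    have h1 : p h s a ∉ t := by
      intro hmem
      rw [Measure.dirac_apply' _ htm] at ht0
      simp [hmem] at ht0
    have h2 : f (p h s a) = g (p h s a) := by
      by_contra hne
      exact h1 (ht hne)
    rwa [← h2]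
  · rwa [integral_non_aestronglyMeasurable hfm]

theorem integral_le_of_forall_le {X : Type*} [MeasurableSpace X] (μ : Measure X)
    [IsProbabilityMeasure μ] (f : X → ℝ) {c : ℝ} (hc : 0 ≤ c) (hf : ∀ x, f x ≤ c) :
    ∫ x, f x ∂μ ≤ c := by
  by_cases hi : Integrable f μ
  · simpa using integral_mono hi (integrable_const c) hf
  · rwa [integral_undef hi]

/-- Backward induction. Any integral that is undefined for a non-measurable policy equals `0`, and
`V* ≥ 0` absorbs this case. -/
theorem valueFrom_le_vStar (hp : P.IsDeterministic p) (π : Policy O A) (n h : ℕ) (hn : h + n = H)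
    (l : List (O × Fin A × ℝ)) (s : S) : P.valueFrom π n h l s ≤ P.vStar p H h s := by
  induction n generalizing h l s with
  | zero => exact P.vStar_nonneg p H h s
  | succ n ih =>
    unfold valueFrom
    refine integral_le_of_forall_le _ _ (P.vStar_nonneg p H h s) fun o => ?_
    have h1 : ∀ r, ∫ s', valueFrom P π n (h + 1) (l ++ [(o, π l o, r)]) s' ∂(P.trans h (π l o) s)
        ≤ P.vStar p H (h + 1) (p h s (π l o)) := fun r =>
      integral_trans_le hp h _ s _ (P.vStar_nonneg p H _ _) (ih (h + 1) (by omega) _ _)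
    refine le_trans ?_ (P.qStar_le_vStar p H h s (π l o))
    rw [P.qStar_eq p H (by omega), ← P.integral_rew_add]
    by_cases hi : Integrable (fun r => r + ∫ s', valueFrom P π n (h + 1) (l ++ [(o, π l o, r)]) s'
        ∂(P.trans h (π l o) s)) (P.rew h (π l o) s)
    · refine integral_mono hi ((P.integrable_rew h _ s).add (integrable_const _)) fun r => ?_
      have := h1 r
      linarith
    · rw [integral_undef hi, P.integral_rew_add]
      exact add_nonneg (P.meanRew_nonneg _ _ _) (P.vStar_nonneg p H _ _)

variable (P) in
/-- The expected sum of the rewards collected from `s` at step `h` by the actions of a list. -/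
noncomputable def seqValue : ℕ → List (Fin A) → S → ℝ
  | _, [], _ => 0
  | h, a :: l, s => P.meanRew h s a + ∫ s', seqValue (h + 1) l s' ∂(P.trans h a s)

/-- Evaluating an integral against a Dirac mass needs a measurable integrand. Kernel integrals
supply this with no hypothesis on `p`. -/
theorem stronglyMeasurable_seqValue (h : ℕ) (l : List (Fin A)) :
    StronglyMeasurable (P.seqValue h l) := by
  induction l generalizing h with
  | nil => exact stronglyMeasurable_const
  | cons a l ih =>
    exact (StronglyMeasurable.integral_kernel (κ := P.rew h a) stronglyMeasurable_id).add
      (StronglyMeasurable.integral_kernel (κ := P.trans h a) (ih (h + 1)))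

theorem seqValue_eq_pathMean (hp : P.IsDeterministic p) (h : ℕ) (l : List (Fin A)) (s : S) :
    P.seqValue h l s = P.pathMean p h s l := by
  induction l generalizing h s with
  | nil => rfl
  | cons a l ih =>
    simp only [seqValue, pathMean]
    rw [hp, integral_dirac' _ _ (stronglyMeasurable_seqValue _ _), ih]

theorem valueFrom_openLoop [NeZero A] (l' l : List (Fin A)) (h : ℕ) (hl : l'.drop h = l)
    (hist : List (O × Fin A × ℝ)) (hh : hist.length = h) (s : S) :
    P.valueFrom (openLoop O l') l.length h hist s = P.seqValue h l s := by
  induction l generalizing h hist s with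
  | nil => rfl
  | cons a l ih =>
    have h1 : l'.getD h 0 = a := by
      have : (l'.drop h)[0]? = some a := by rw [hl]; rfl
      rw [List.getElem?_drop] at this
      simp only [add_zero] at this
      simp [this]
    have h2 : l'.drop (h + 1) = l := by
      rw [← List.drop_drop, hl]; rfl
    have h3 : ∀ o : O, openLoop O l' hist o = a := fun o => by
      simp only [openLoop, hh, h1]
    simp only [List.length_cons, valueFrom, seqValue, h3]
    have h4 : ∀ (x : O × Fin A × ℝ) (s' : S),
        P.valueFrom (openLoop O l') l.length (h + 1) (hist ++ [x]) s' = P.seqValue (h + 1) l s' :=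
      fun x s' => ih (h + 1) h2 _ (by simp [hh]) s'
    simp only [h4, integral_rew_add, integral_const, probReal_univ, one_smul]

theorem isOptimalActions_of_pathMean_eq [NeZero A] (hp : P.IsDeterministic p)
    {l : List (Fin A)} (hl : l.length = H)
    (hV : P.pathMean p 0 P.init l = P.vStar p H 0 P.init) : P.IsOptimalActions H l := by
  refine ⟨hl, fun π => ?_⟩
  refine (valueFrom_le_vStar H hp π H 0 (by simp) [] P.init).trans ?_
  rw [← hV, ← seqValue_eq_pathMean hp, ← valueFrom_openLoop l l 0 rfl [] rfl, hl]
  rfl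

end Values

/-! ### Laws of a single reward and of an observation window within an episode. -/

section Marginals

variable {P : POMDP S O A} {p : ℕ → S → Fin A → S}

theorem comp_trans_apply (hp : P.IsDeterministic p) {X : Type*} [MeasurableSpace X]
    (κ : Kernel S X) (h : ℕ) (a : Fin A) (s : S) : (κ ∘ₖ P.trans h a) s = κ (p h s a) := by
  rw [Kernel.comp_apply, hp, Measure.dirac_bind κ.measurable]

theorem episode_succ_apply (hp : P.IsDeterministic p) (n h : ℕ) (a : Fin (n + 1) → Fin A) (s : S) :
    P.episode (n + 1) h a s
      = (((P.emit h s).prod (P.rew h (a 0) s)).prod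
          (P.episode n (h + 1) (fun i => a i.succ) (p h s (a 0)))).map
        (fun x => (Fin.cons x.1 x.2 : Fin (n + 1) → O × ℝ)) := by
  rw [episode, Kernel.map_apply _ (measurable_cons n), Kernel.prod_apply, Kernel.prod_apply,
    comp_trans_apply hp]

theorem window_succ_apply (hp : P.IsDeterministic p) (n h : ℕ) (b : Fin (n + 1) → Fin A) (s : S) :
    P.window (n + 1) h b s
      = ((P.emit h s).prod (P.window n (h + 1) (fun i => b i.succ) (p h s (b 0)))).map
        (fun x => (Fin.cons x.1 x.2 : Fin (n + 2) → O)) := by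
  rw [window, Kernel.map_apply _ (measurable_cons (n + 1)), Kernel.prod_apply,
    comp_trans_apply hp]

/-- With a deterministic next state, an episode is the product of its first step and a shorter
episode. The marginals of later steps follow by peeling off one step at a time. -/
theorem map_tail_episode (hp : P.IsDeterministic p) (n h : ℕ) (a : Fin (n + 1) → Fin A) (s : S) :
    (P.episode (n + 1) h a s).map (fun x i => x (Fin.succ i))
      = P.episode n (h + 1) (fun i => a i.succ) (p h s (a 0)) := by
  rw [episode_succ_apply hp, Measure.map_map (by fun_prop) (measurable_cons n)]
  simp only [Function.comp_def, Fin.cons_succ]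
  exact Measure.map_snd_prod.trans (by simp)

theorem map_reward_episode (hp : P.IsDeterministic p) (l : List (Fin A)) (n h : ℕ)
    (a : Fin n → Fin A) (s : S) (hn : l.length < n)
    (ha : ∀ (j : Fin n) (hj : j < l.length), a j = l[j]) :
    (P.episode n h a s).map (fun x => (x ⟨l.length, hn⟩).2)
      = P.rew (h + l.length) (a ⟨l.length, hn⟩) (stateFrom p h s l) := by
  induction l generalizing n h s with
  | nil =>
    obtain ⟨n, rfl⟩ : ∃ m, n = m + 1 := ⟨n - 1, by simp at hn; omega⟩
    rw [episode_succ_apply hp, Measure.map_map (by fun_prop) (measurable_cons n)]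
    have : (fun x : Fin (n + 1) → O × ℝ => (x ⟨([] : List (Fin A)).length, hn⟩).2) ∘
        (fun x : (O × ℝ) × (Fin n → O × ℝ) => (Fin.cons x.1 x.2 : Fin (n + 1) → O × ℝ))
        = Prod.snd ∘ Prod.fst := by
      funext x; rfl
    rw [this, ← Measure.map_map measurable_snd measurable_fst, Measure.map_fst_prod]
    simp [stateFrom]
  | cons b l ih =>
    obtain ⟨n, rfl⟩ : ∃ m, n = m + 1 := ⟨n - 1, by simp at hn; omega⟩
    have hn' : l.length < n := by simpa using hn
    have h1 := ih n (h + 1) (fun i => a i.succ) (p h s (a 0)) hn' fun j hj => by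
      have := ha j.succ (by simpa using hj)
      simpa using this
    rw [← map_tail_episode hp, Measure.map_map (by fun_prop) (by fun_prop)] at h1
    have h2 : a 0 = b := ha 0 (by simp)
    rw [h2] at h1
    simp only [stateFrom, List.length_cons]
    rw [show h + (l.length + 1) = h + 1 + l.length by ring]
    exact h1

theorem map_obs_episode_zero (hp : P.IsDeterministic p) (m n h : ℕ)
    (a : Fin n → Fin A) (b : Fin m → Fin A) (s : S) (hn : m < n)
    (hb : ∀ j : Fin m, a ⟨j, by omega⟩ = b j) :
    (P.episode n h a s).map (fun x (j : Fin (m + 1)) => (x ⟨j, by omega⟩).1) = P.window m h b s := by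
  induction m generalizing n h s with
  | zero =>
    obtain ⟨n, rfl⟩ : ∃ m, n = m + 1 := ⟨n - 1, by omega⟩
    rw [episode_succ_apply hp, Measure.map_map (by fun_prop) (measurable_cons n)]
    have : (fun (x : Fin (n + 1) → O × ℝ) (j : Fin (0 + 1)) => (x ⟨j, by omega⟩).1) ∘
        (fun x : (O × ℝ) × (Fin n → O × ℝ) => (Fin.cons x.1 x.2 : Fin (n + 1) → O × ℝ))
        = (fun o _ => o) ∘ Prod.fst ∘ Prod.fst := by
      funext x j
      obtain rfl : j = 0 := Fin.fin_one_eq_zero j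
      rfl
    rw [this, ← Measure.map_map (by fun_prop) (by fun_prop),
      ← Measure.map_map measurable_fst measurable_fst, Measure.map_fst_prod]
    rw [window, Kernel.map_apply _ (measurable_pi_lambda _ (fun _ => measurable_id'))]
    simp
  | succ m ih =>
    obtain ⟨n, rfl⟩ : ∃ m, n = m + 1 := ⟨n - 1, by omega⟩
    have h1 := ih n (h + 1) (fun i => a i.succ) (fun i => b i.succ) (p h s (a 0)) (by omega)
      fun j => hb j.succ
    have h2 : a 0 = b 0 := hb 0
    rw [h2] at h1
    rw [window_succ_apply hp, ← h1, episode_succ_apply hp, h2,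
      Measure.map_map (by fun_prop) (measurable_cons n)]
    -- A window draws no reward. Writing the emission law as a marginal makes both sides images of
    -- the same product.
    have h3 : P.emit h s = ((P.emit h s).prod (P.rew h (b 0) s)).map Prod.fst := by
      simp [Measure.map_fst_prod]
    conv_rhs => rw [h3]
    rw [Measure.map_prod_map _ _ (by fun_prop) (by fun_prop),
      Measure.map_map (measurable_cons _) (by fun_prop)]
    congr 1
    funext x j
    refine Fin.cases ?_ (fun j => ?_) j <;> rfl

theorem map_obs_episode (hp : P.IsDeterministic p) (l : List (Fin A)) (m n h : ℕ)
    (a : Fin n → Fin A) (b : Fin m → Fin A) (s : S) (hn : l.length + m < n)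
    (ha : ∀ (j : Fin n) (hj : j < l.length), a j = l[j])
    (hb : ∀ j : Fin m, a ⟨l.length + j, by omega⟩ = b j) :
    (P.episode n h a s).map (fun x (j : Fin (m + 1)) => (x ⟨l.length + j, by omega⟩).1)
      = P.window m (h + l.length) b (stateFrom p h s l) := by
  induction l generalizing n h s with
  | nil =>
    have := map_obs_episode_zero hp m n h a b s (by simpa using hn) (by simpa using hb)
    simpa [stateFrom] using this
  | cons c l ih =>
    obtain ⟨n, rfl⟩ : ∃ m, n = m + 1 := ⟨n - 1, by simp at hn; omega⟩
    have hn' : l.length + m < n := by simp at hn; omega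
    have h1 := ih n (h + 1) (fun i => a i.succ) (p h s (a 0)) hn' (fun j hj => by
      have := ha j.succ (by simpa using hj)
      simpa using this) (fun j => by
      rw [← hb j]
      congr 1
      ext
      simp; omega)
    rw [← map_tail_episode hp, Measure.map_map (by fun_prop) (by fun_prop)] at h1
    have h2 : a 0 = c := ha 0 (by simp)
    rw [h2] at h1
    simp only [stateFrom, List.length_cons]
    rw [show h + (l.length + 1) = h + 1 + l.length by ring, ← h1]
    congr 1
    funext x j
    simp only [Function.comp]
    congr 2
    ext
    simp; omega

end Marginals

end POMDP

/-! ## Concentration on the tape -/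

section Features

variable {O : Type*} {H k A d : ℕ}

/-- The first `t` actions of a sequence. -/
def pre (act : ℕ → Fin A) (t : ℕ) : List (Fin A) := (List.range t).map act

theorem pre_succ (act : ℕ → Fin A) (t : ℕ) : pre act (t + 1) = pre act t ++ [act t] := by
  simp [pre, List.range_succ]

@[simp] theorem length_pre (act : ℕ → Fin A) (t : ℕ) : (pre act t).length = t := by simp [pre]

theorem pre_congr {act act' : ℕ → Fin A} {t : ℕ} (h : ∀ i < t, act i = act' i) :
    pre act t = pre act' t := by
  refine List.map_congr_left fun i hi => h i (List.mem_range.1 hi)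

/-- The vector that has `θ` in the block `b` and zeros elsewhere. -/
noncomputable def blockVec (b : Fin k → Fin A) (θ : EuclideanSpace ℝ (Fin d)) : Feat k A d :=
  fun bj => if bj.1 = b then θ bj.2 else 0

theorem blockVec_dotProduct (b : Fin k → Fin A) (θ : EuclideanSpace ℝ (Fin d)) (x : Feat k A d) :
    blockVec b θ ⬝ᵥ x = ∑ j, θ j * x (b, j) := by
  simp [blockVec, dotProduct, Fintype.sum_prod_type, ite_mul]

theorem blockVec_dotProduct_self (b : Fin k → Fin A) (θ : EuclideanSpace ℝ (Fin d)) :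
    blockVec b θ ⬝ᵥ blockVec b θ = ‖θ‖ ^ 2 := by
  rw [blockVec_dotProduct, EuclideanSpace.norm_sq_eq]
  simp [blockVec, pow_two]

variable [NeZero A]

theorem planOf_append_left (l l' : List (Fin A)) (j : Fin (H + k)) (hj : j < l.length) :
    planOf H k (l ++ l') j = l[j] := by
  simp [planOf, List.getElem?_append_left hj, List.getElem?_eq_getElem hj]

theorem planOf_append_right (l : List (Fin A)) {m : ℕ} (b : Fin m → Fin A) (j : Fin m)
    (hj : l.length + j < H + k) :
    planOf H k (l ++ List.ofFn b) ⟨l.length + j, hj⟩ = b j := by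
  simp [planOf]

/-- Pairing with a block vector leaves a scalar average over the episodes of one sequence `b`, so no
dimension enters the concentration bound. -/
theorem blockVec_dotProduct_featEst (I : AlgInput k A d O) (ω : Tape H k A O)
    (b : Fin k → Fin A) (θ : EuclideanSpace ℝ (Fin d)) (h : Fin H) (l : List (Fin A)) (n : ℕ) :
    blockVec b θ ⬝ᵥ featEst I ω h l n
      = (∑ i : Fin I.M, inner ℝ θ (I.ψ (obsWindow h
          (ω (n + I.M * (finFunctionFinEquiv b : Fin (A ^ k)) + i,
            planOf H k (l ++ List.ofFn b)))))) / I.M := by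
  rw [blockVec_dotProduct]
  simp only [featEst, ← mul_div_assoc, ← Finset.sum_div, Finset.mul_sum]
  rw [Finset.sum_comm]
  simp only [PiLp.inner_apply, RCLike.inner_apply, conj_trivial, mul_comm]

theorem featEst_dotProduct_self_le (I : AlgInput k A d O) (hψ : ∀ o, ‖I.ψ o‖ ≤ 1)
    (ω : Tape H k A O) (h : Fin H) (l : List (Fin A)) (n : ℕ) :
    featEst I ω h l n ⬝ᵥ featEst I ω h l n ≤ (A : ℝ) ^ k := by
  have h1 : ∀ b : Fin k → Fin A,
      ∑ j, featEst I ω h l n (b, j) * featEst I ω h l n (b, j) ≤ 1 := by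
    intro b
    set v : EuclideanSpace ℝ (Fin d) := (I.M : ℝ)⁻¹ • ∑ i : Fin I.M, I.ψ (obsWindow h
          (ω (n + I.M * (finFunctionFinEquiv b : Fin (A ^ k)) + i,
            planOf H k (l ++ List.ofFn b)))) with hv
    have h2 : ∀ j, featEst I ω h l n (b, j) = v j := by
      intro j
      simp [hv, featEst, div_eq_inv_mul]
    have h3 : ‖v‖ ≤ 1 := by
      rw [hv, norm_smul, norm_inv, Real.norm_natCast]
      refine inv_mul_le_one_of_le₀ ?_ (Nat.cast_nonneg _)
      simpa using norm_sum_le_of_le Finset.univ (fun (i : Fin I.M) _ => hψ (obsWindow h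
          (ω (n + I.M * (finFunctionFinEquiv b : Fin (A ^ k)) + i,
            planOf H k (l ++ List.ofFn b)))))
    have h4 : ‖v‖ ^ 2 ≤ 1 := by nlinarith [norm_nonneg v]
    rw [EuclideanSpace.norm_sq_eq] at h4
    simpa [h2, pow_two] using h4
  rw [dotProduct, Fintype.sum_prod_type]
  refine (Finset.sum_le_sum fun b _ => h1 b).trans ?_
  simp

end Features

/-! ### Hoeffding bounds on the tape and the union bound. -/

section Concentration

variable {S O : Type*} [MeasurableSpace S] [MeasurableSpace O] {H k A d : ℕ}

/-- Distinct tape entries are independent, so injectivity of `idx` is all the independence required.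
The indices are fixed in advance; adaptive choices are left to the union bound. -/
theorem tapeLaw_hoeffding (P : POMDP S O A) {ι : Type*} [Fintype ι]
    (idx : ι → ℕ × Plan H k A) (hinj : Function.Injective idx) (f : ι → Outcome H k O → ℝ)
    (hf : ∀ i, Measurable (f i)) (m : ι → ℝ) {α β ε : ℝ} (hε : 0 ≤ ε)
    (hb : ∀ i, ∀ᵐ x ∂(P.episode (H + k) 0 (idx i).2 P.init), f i x ∈ Set.Icc α β)
    (hm : ∀ i, ∫ x, f i x ∂(P.episode (H + k) 0 (idx i).2 P.init) = m i) :
    tapeLaw P H k {ω | ε < |∑ i, (f i (ω (idx i)) - m i)|}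
      ≤ ENNReal.ofReal (2 * Real.exp (-(2 * ε ^ 2) / (Fintype.card ι * (β - α) ^ 2))) := by
  have hmap : ∀ i, (tapeLaw P H k).map (fun ω => ω (idx i))
      = P.episode (H + k) 0 (idx i).2 P.init := fun i => Measure.infinitePi_map_eval _ _
  have hsub : ∀ i, HasSubgaussianMGF (fun ω : Tape H k A O => f i (ω (idx i)) - m i)
      ((‖β - α‖₊ / 2) ^ 2) (tapeLaw P H k) := by
    intro i
    have hint : ∫ ω, f i (ω (idx i)) ∂(tapeLaw P H k) = m i := by
      rw [← hm i, ← hmap i, integral_map (measurable_pi_apply _).aemeasurable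
        (hf i).aestronglyMeasurable]
    rw [← hint]
    refine hasSubgaussianMGF_of_mem_Icc ((hf i).comp (measurable_pi_apply _)).aemeasurable ?_
    have := hb i
    rw [← hmap i] at this
    exact ae_of_ae_map (f := fun ω : Tape H k A O => ω (idx i))
      (measurable_pi_apply _).aemeasurable this
  have hind : iIndepFun (fun i (ω : Tape H k A O) => f i (ω (idx i)) - m i) (tapeLaw P H k) := by
    have h1 : iIndepFun (fun (j : ℕ × Plan H k A) (ω : Tape H k A O) => ω j) (tapeLaw P H k) :=
      iIndepFun_infinitePi (X := fun _ x => x) (by fun_prop)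
    exact (h1.precomp hinj).comp (fun i x => f i x - m i) fun i => (hf i).sub_const _
  -- Each summand has sub-Gaussian parameter `((β - α) / 2) ^ 2`. In the degenerate case both sides
  -- are divisions by zero, hence equal.
  have hc : -ε ^ 2 / (2 * ((∑ _i : ι, (‖β - α‖₊ / 2) ^ 2 : NNReal) : ℝ))
      = -(2 * ε ^ 2) / (Fintype.card ι * (β - α) ^ 2) := by
    simp only [Finset.sum_const, Finset.card_univ, nsmul_eq_mul]
    push_cast
    rw [Real.norm_eq_abs, div_pow, sq_abs]
    rcases eq_or_ne ((Fintype.card ι : ℝ) * (β - α) ^ 2) 0 with h0 | h0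
    · rw [h0, show (2 : ℝ) * (Fintype.card ι * ((β - α) ^ 2 / 2 ^ 2))
        = (Fintype.card ι * (β - α) ^ 2) / 2 by ring, h0]
      simp
    · field_simp
  have hsum := HasSubgaussianMGF.sum_of_iIndepFun hind (s := Finset.univ) fun i _ => hsub i
  have hup := hsum.measure_ge_le hε
  have hlo := hsum.neg.measure_ge_le hε
  rw [hc] at hup hlo
  have hle : {ω : Tape H k A O | ε < |∑ i, (f i (ω (idx i)) - m i)|}
      ⊆ {ω | ε ≤ ∑ i, (f i (ω (idx i)) - m i)}
        ∪ {ω | ε ≤ (-fun ω : Tape H k A O => ∑ i, (f i (ω (idx i)) - m i)) ω} := by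
    intro ω hω
    rcases lt_abs.1 (Set.mem_ofPred_eq ▸ hω) with h | h
    · exact Or.inl h.le
    · exact Or.inr (by simpa using h.le)
  refine (measure_mono hle).trans ((measure_union_le _ _).trans ?_)
  rw [two_mul, ENNReal.ofReal_add (Real.exp_pos _).le (Real.exp_pos _).le]
  exact add_le_add (ENNReal.le_ofReal_iff_toReal_le (measure_ne_top _ _) (Real.exp_pos _).le |>.2 hup)
    (ENNReal.le_ofReal_iff_toReal_le (measure_ne_top _ _) (Real.exp_pos _).le |>.2 hlo)

variable [NeZero A]

/-- The samples `⟨θ, ψ⟩` lie in `[-Θ, Θ]`, of width `2 Θ`, so the exponent is `2 (e M)² / (M (2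
Θ)²)`. -/
theorem featEst_tail {P : POMDP S O A} {p : ℕ → S → Fin A → S} (hp : P.IsDeterministic p)
    (I : AlgInput k A d O) (hM : 0 < I.M) (hψm : Measurable I.ψ) (hψ : ∀ o, ‖I.ψ o‖ ≤ 1)
    (b : Fin k → Fin A) (θ : EuclideanSpace ℝ (Fin d)) {Θ : ℝ} (hθ : ‖θ‖ ≤ Θ)
    (h : Fin H) (l : List (Fin A)) (hl : l.length = h) (n : ℕ) {e : ℝ} (he : 0 ≤ e) :
    tapeLaw P H k {ω | e < |blockVec b θ ⬝ᵥ featEst I ω h l n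
        - inner ℝ θ (∫ o, I.ψ o ∂(P.window k h b (POMDP.stateFrom p 0 P.init l)))|}
      ≤ ENNReal.ofReal (2 * Real.exp (-(e ^ 2 * I.M) / (2 * Θ ^ 2))) := by
  set q := inner ℝ θ (∫ o, I.ψ o ∂(P.window k h b (POMDP.stateFrom p 0 P.init l))) with hq
  have hM' : (0 : ℝ) < I.M := Nat.cast_pos.2 hM
  have hobs : Measurable (obsWindow h : Outcome H k O → _) := by
    unfold obsWindow; fun_prop
  have h1 := tapeLaw_hoeffding P
    (fun i : Fin I.M => (n + I.M * (finFunctionFinEquiv b : Fin (A ^ k)) + (i : ℕ),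
            planOf H k (l ++ List.ofFn b)))
    (fun i j hij => by
      have := congrArg Prod.fst hij
      exact Fin.ext (by simpa using this))
    (fun _ x => inner ℝ θ (I.ψ (obsWindow h x))) (fun _ => by fun_prop) (fun _ => q)
    (α := -Θ) (β := Θ) (ε := e * I.M) (by positivity)
    (fun _ => ae_of_all _ fun x => by
      have h2 := abs_real_inner_le_norm θ (I.ψ (obsWindow h x))
      have h3 : ‖θ‖ * ‖I.ψ (obsWindow h x)‖ ≤ Θ * 1 :=
        mul_le_mul hθ (hψ _) (norm_nonneg _) ((norm_nonneg _).trans hθ)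
      exact abs_le.1 (by linarith))
    (fun _ => by
      have h4 := POMDP.map_obs_episode hp l k (H + k) 0 (planOf H k (l ++ List.ofFn b)) b P.init
        (by omega) (planOf_append_left _ _)
        (fun j => planOf_append_right _ _ _ _)
      have h5 : (fun (x : Fin (H + k) → O × ℝ) (j : Fin (k + 1)) =>
          (x ⟨l.length + j, by omega⟩).1) = obsWindow h := by
        funext x j
        simp [obsWindow, hl]
      rw [h5, zero_add, hl] at h4
      have hint : Integrable I.ψ (P.window k h b (POMDP.stateFrom p 0 P.init l)) :=
        Integrable.of_bound hψm.aestronglyMeasurable 1 (ae_of_all _ hψ)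
      rw [hq, ← integral_inner hint, ← h4, integral_map hobs.aemeasurable]
      exact (Measurable.aestronglyMeasurable (by fun_prop)))
  refine (measure_mono ?_).trans (h1.trans (ENNReal.ofReal_le_ofReal (le_of_eq ?_)))
  · intro ω hω
    simp only [Set.mem_ofPred_eq] at hω ⊢
    rw [blockVec_dotProduct_featEst] at hω
    rw [Finset.sum_sub_distrib, Finset.sum_const, Finset.card_univ, Fintype.card_fin, nsmul_eq_mul,
      ← lt_div_iff₀ hM', ← abs_of_pos hM', ← abs_div, abs_of_pos hM', sub_div,
      mul_div_cancel_left₀ _ hM'.ne']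
    exact hω
  · rw [Fintype.card_fin]
    congr 2
    rcases eq_or_ne Θ 0 with h0 | h0
    · simp [h0]
    · field_simp
      ring

/-- The deviation of the reward estimate of step `t` along a sequence of actions, based on the
episodes from `idx t` on. -/
noncomputable def rewDev (I : AlgInput k A d O) (ω : Tape H k A O) (P : POMDP S O A)
    (p : ℕ → S → Fin A → S) (act : ℕ → Fin A) (idx : ℕ → ℕ) (t : Fin H) : ℝ :=
  rewEst I ω t (pre act (t + 1)) (idx t)
    - P.meanRew t (POMDP.stateFrom p 0 P.init (pre act t)) (act t)

/-- The sum of the deviations of the reward estimates of the steps `t ≥ h`. -/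
noncomputable def pathDev (I : AlgInput k A d O) (ω : Tape H k A O) (P : POMDP S O A)
    (p : ℕ → S → Fin A → S) (act : ℕ → Fin A) (idx : ℕ → ℕ) (h : ℕ) : ℝ :=
  ∑ t : Fin H, if h ≤ t then rewDev I ω P p act idx t else 0

theorem pathDev_congr (I : AlgInput k A d O) (ω : Tape H k A O) (P : POMDP S O A)
    (p : ℕ → S → Fin A → S) {act act' : ℕ → Fin A} {idx idx' : ℕ → ℕ} {h : ℕ}
    (hact : ∀ t < H, act t = act' t) (hidx : ∀ t, h ≤ t → t < H → idx t = idx' t) :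
    pathDev I ω P p act idx h = pathDev I ω P p act' idx' h := by
  refine Finset.sum_congr rfl fun t _ => ?_
  split_ifs with ht
  · have ht' := t.2
    rw [rewDev, rewDev, pre_congr (t := t + 1) (act' := act') fun i hi => hact i (by omega),
      pre_congr (t := t) (act' := act') fun i hi => hact i (by omega), hidx t ht t.2, hact t t.2]
  · rfl

theorem pathDev_eq (I : AlgInput k A d O) (ω : Tape H k A O) (P : POMDP S O A)
    (p : ℕ → S → Fin A → S) (act : ℕ → Fin A) (idx : ℕ → ℕ) (h : Fin H) :
    pathDev I ω P p act idx h
      = rewDev I ω P p act idx h + pathDev I ω P p act idx (h + 1) := by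
  rw [pathDev, pathDev, ← Finset.add_sum_erase _ _ (Finset.mem_univ h), if_pos le_rfl,
    ← Finset.add_sum_erase (a := h) _ (fun t : Fin H => if (h : ℕ) + 1 ≤ t then _ else (0 : ℝ))
      (Finset.mem_univ h), if_neg (by omega), zero_add]
  congr 1
  refine Finset.sum_congr rfl fun t ht => ?_
  have : (t : ℕ) ≠ h := fun h' => Finset.ne_of_mem_erase ht (Fin.ext h')
  congr 1
  exact propext ⟨fun _ => by omega, fun _ => by omega⟩

/-- The blocks of `M` episodes that start at `idx t`, for `h ≤ t < H`, follow each other. -/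
def Spaced (H M : ℕ) (idx : ℕ → ℕ) (h : ℕ) : Prop :=
  ∀ t, h ≤ t → t + 1 < H → idx t + M ≤ idx (t + 1)

theorem Spaced.le {M : ℕ} {idx : ℕ → ℕ} {h : ℕ} (hs : Spaced H M idx h) {t t' : ℕ}
    (ht : h ≤ t) (htt' : t < t') (ht' : t' < H) : idx t + M ≤ idx t' := by
  induction t', htt' using Nat.le_induction with
  | base => exact hs t ht ht'
  | succ t' htt' ih =>
    have h1 := ih (by omega)
    have h2 := hs t' (by omega) ht'
    omega

/-- The rewards of the whole path, at most `H * M` of them, form one independent sum. This gives a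
deviation of order `√(H / M)`, where adding separate bounds for the steps would give `H / √M`. -/
theorem pathDev_tail {P : POMDP S O A} {p : ℕ → S → Fin A → S} (hp : P.IsDeterministic p)
    (I : AlgInput k A d O) (hM : 0 < I.M) (act : ℕ → Fin A) (idx : ℕ → ℕ) (h : Fin H)
    (hs : Spaced H I.M idx h) {e : ℝ} (he : 0 ≤ e) :
    tapeLaw P H k {ω | e < |pathDev I ω P p act idx h|}
      ≤ ENNReal.ofReal (2 * Real.exp (-(2 * e ^ 2 * I.M) / H)) := by
  have hM' : (0 : ℝ) < I.M := Nat.cast_pos.2 hM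
  have hH : (0 : ℝ) < H := Nat.cast_pos.2 h.pos
  set m : Fin H → ℝ := fun t => P.meanRew t (POMDP.stateFrom p 0 P.init (pre act t)) (act t)
    with hm
  have hrew : ∀ t : Fin H, (P.episode (H + k) 0 (planOf H k (pre act (t + 1))) P.init).map
      (rewardAt t) = P.rew t (act t) (POMDP.stateFrom p 0 P.init (pre act t)) := by
    intro t
    have h1 := POMDP.map_reward_episode hp (pre act t) (H + k) 0
      (planOf H k (pre act (t + 1))) P.init (by rw [length_pre]; omega)
      (fun j hj => by rw [pre_succ]; exact planOf_append_left _ _ _ hj)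
    have h2 : planOf H k (pre act (t + 1)) ⟨(pre act t).length, by rw [length_pre]; omega⟩
        = act t := by
      have := planOf_append_right (k := k) (H := H) (pre act t) (fun _ : Fin 1 => act t) 0
        (by rw [length_pre]; simp; omega)
      simpa [pre_succ] using this
    rw [h2, zero_add] at h1
    simp only [length_pre] at h1
    exact h1
  have hmeas : ∀ t : Fin H, Measurable (rewardAt t : Outcome H k O → ℝ) := fun t => by
    unfold rewardAt; fun_prop
  have h1 := tapeLaw_hoeffding P
    (fun i : {t : Fin H // h ≤ t} × Fin I.M =>
      (idx i.1 + (i.2 : ℕ), planOf H k (pre act (i.1.1 + 1))))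
    (fun i j hij => by
      have h3 : idx i.1 + (i.2 : ℕ) = idx j.1 + (j.2 : ℕ) := congrArg Prod.fst hij
      have hi := i.2.2
      have hj := j.2.2
      -- Spaced blocks of different steps are disjoint, so a common episode number forces a common
      -- step.
      have h4 : i.1 = j.1 := by
        rcases lt_trichotomy (i.1.1 : ℕ) (j.1.1 : ℕ) with hlt | heq | hlt
        · have := hs.le i.1.2 hlt j.1.1.2
          omega
        · exact Subtype.ext (Fin.ext heq)
        · have := hs.le j.1.2 hlt i.1.1.2
          omega
      refine Prod.ext h4 (Fin.ext ?_)
      rw [h4] at h3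
      omega)
    (fun i => rewardAt i.1.1) (fun i => hmeas _) (fun i => m i.1) (α := 0) (β := 1)
    (ε := e * I.M) (by positivity)
    (fun i => by
      have h2 := P.rew_mem i.1.1 (act i.1.1) (POMDP.stateFrom p 0 P.init (pre act i.1.1))
      rw [← hrew] at h2
      exact ae_of_ae_map (hmeas _).aemeasurable h2)
    (fun i => by
      rw [hm]
      simp only [POMDP.meanRew]
      rw [← hrew]
      exact (integral_map (f := fun r : ℝ => r) (hmeas _).aemeasurable
        measurable_id.aestronglyMeasurable).symm)
  have hdev : ∀ ω, pathDev I ω P p act idx h * I.M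
      = ∑ i : {t : Fin H // h ≤ t} × Fin I.M,
        (rewardAt i.1.1 (ω (idx i.1 + (i.2 : ℕ), planOf H k (pre act (i.1.1 + 1)))) - m i.1) := by
    intro ω
    rw [Fintype.sum_prod_type, pathDev, ← Finset.sum_filter, Finset.sum_mul]
    simp only [Fin.val_fin_le]
    rw [← Finset.sum_subtype_eq_sum_filter, Finset.subtype_univ]
    refine Finset.sum_congr rfl fun t _ => ?_
    rw [Finset.sum_sub_distrib, rewDev, rewEst, sub_mul, div_mul_cancel₀ _ hM'.ne']
    simp [hm, mul_comm]
  refine (measure_mono ?_).trans (h1.trans (ENNReal.ofReal_le_ofReal ?_))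
  · intro ω hω
    simp only [Set.mem_ofPred_eq] at hω ⊢
    rw [← hdev, abs_mul, abs_of_pos hM']
    exact mul_lt_mul_of_pos_right hω hM'
  · have hc1 : 0 < Fintype.card {t : Fin H // h ≤ t} := Fintype.card_pos_iff.2 ⟨⟨h, le_rfl⟩⟩
    have hc2 : Fintype.card {t : Fin H // h ≤ t} ≤ H := by
      simpa using Fintype.card_subtype_le (fun t : Fin H => h ≤ t)
    have hc1' : (0 : ℝ) < Fintype.card {t : Fin H // h ≤ t} := Nat.cast_pos.2 hc1
    have hc2' : (Fintype.card {t : Fin H // h ≤ t} : ℝ) ≤ H := Nat.cast_le.2 hc2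
    rw [Fintype.card_prod, Fintype.card_fin, Nat.cast_mul]
    gcongr 2 * Real.exp ?_
    rw [neg_div, neg_div, neg_le_neg_iff, div_le_div_iff₀ hH (by positivity)]
    have : 2 * e ^ 2 * I.M ^ 2 * Fintype.card {t : Fin H // h ≤ t} ≤ 2 * e ^ 2 * I.M ^ 2 * H := by
      gcongr
    nlinarith

/-- All estimates with episodes before the `N`-th are accurate up to `e`. -/
structure GoodTape (I : AlgInput k A d O) (P : POMDP S O A) (p : ℕ → S → Fin A → S)
    (θ : Fin H → Fin A → Feat k A d) (e : ℝ) (N : ℕ) (ω : Tape H k A O) : Prop where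
  feat : ∀ (h : Fin H) (a : Fin A) (act : ℕ → Fin A) (n : ℕ), n < N →
    |θ h a ⬝ᵥ featEst I ω h (pre act h) n
      - P.qStar p H h (POMDP.stateFrom p 0 P.init (pre act h)) a| ≤ e
  rew : ∀ (h : Fin H) (act : ℕ → Fin A) (idx : ℕ → ℕ), Spaced H I.M idx h →
    (∀ t : ℕ, h ≤ t → t < H → idx t < N) → |pathDev I ω P p act idx h| ≤ e

/-- Extend a sequence of actions of length `H` by an arbitrary fixed action. -/
def extendAct (act : Fin H → Fin A) (t : ℕ) : Fin A := if ht : t < H then act ⟨t, ht⟩ else 0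

theorem measure_iUnion_le_card_mul {Ω ι : Type*} [MeasurableSpace Ω] [Fintype ι] (μ : Measure Ω)
    (s : ι → Set Ω) {b : ℝ} (h : ∀ i, μ (s i) ≤ ENNReal.ofReal b) :
    μ (⋃ i, s i) ≤ ENNReal.ofReal (Fintype.card ι * b) := by
  refine (measure_iUnion_fintype_le μ s).trans ((Finset.sum_le_sum fun i _ => h i).trans ?_)
  rw [Finset.sum_const, Finset.card_univ, ENNReal.ofReal_mul (Nat.cast_nonneg _),
    ENNReal.ofReal_natCast, nsmul_eq_mul]

/-- A union bound over everything the algorithm could ask for: first episodes below `N` for the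
features, and whole maps from steps to first episodes for the path sums. The events refer to no
decision of the algorithm, so adaptivity costs only their number. -/
theorem goodTape_compl {P : POMDP S O A} {p : ℕ → S → Fin A → S} (hp : P.IsDeterministic p)
    (I : AlgInput k A d O) (hM : 0 < I.M) (hψm : Measurable I.ψ) (hψ : ∀ o, ‖I.ψ o‖ ≤ 1)
    (b : Fin H → Fin k → Fin A) (θ : Fin H → Fin A → EuclideanSpace ℝ (Fin d)) {Θ : ℝ}
    (hθ : ∀ h a, ‖θ h a‖ ≤ Θ)
    (hq : ∀ (h : Fin H) a s, P.qStar p H h s a = inner ℝ (θ h a) (∫ o, I.ψ o ∂(P.window k h (b h) s)))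
    {e : ℝ} (he : 0 ≤ e) (N : ℕ) :
    tapeLaw P H k {ω | ¬ GoodTape I P p (fun h a => blockVec (b h) (θ h a)) e N ω}
      ≤ ENNReal.ofReal (H * A * A ^ H * N * (2 * Real.exp (-(e ^ 2 * I.M) / (2 * Θ ^ 2))))
        + ENNReal.ofReal (H * A ^ H * N ^ H * (2 * Real.exp (-(2 * e ^ 2 * I.M) / H))) := by
  classical
  let F : Fin H × Fin A × (Fin H → Fin A) × Fin N → Set (Tape H k A O) := fun i =>
    {ω | e < |blockVec (b i.1) (θ i.1 i.2.1) ⬝ᵥ featEst I ω i.1 (pre (extendAct i.2.2.1) i.1) i.2.2.2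
      - inner ℝ (θ i.1 i.2.1) (∫ o, I.ψ o ∂(P.window k i.1 (b i.1)
        (POMDP.stateFrom p 0 P.init (pre (extendAct i.2.2.1) i.1))))|}
  let ext : (Fin H → Fin N) → ℕ → ℕ := fun idx t => if ht : t < H then idx ⟨t, ht⟩ else 0
  let R : Fin H × (Fin H → Fin A) × (Fin H → Fin N) → Set (Tape H k A O) := fun i =>
    if Spaced H I.M (ext i.2.2) i.1 then
      {ω | e < |pathDev I ω P p (extendAct i.2.1) (ext i.2.2) i.1|} else ∅
  have hsub : {ω | ¬ GoodTape I P p (fun h a => blockVec (b h) (θ h a)) e N ω}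
      ⊆ (⋃ i, F i) ∪ ⋃ i, R i := by
    intro ω hω
    by_contra hnot
    rw [Set.mem_union, not_or, Set.mem_iUnion, Set.mem_iUnion, not_exists, not_exists] at hnot
    refine hω ⟨fun h a act n hn => ?_, fun h act idx hs hN => ?_⟩
    · have h1 := hnot.1 (h, a, fun t => act t, ⟨n, hn⟩)
      have h2 : pre (extendAct fun t : Fin H => act t) h = pre act h :=
        pre_congr fun i hi => by
          have := h.2
          simp [extendAct, show i < H by omega]
      simp only [F, Set.mem_ofPred_eq, not_lt, h2] at h1
      rw [hq]
      exact h1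
    · rcases Nat.eq_zero_or_pos N with h0 | h0
      · have := hN h le_rfl h.2
        omega
      set idx' : Fin H → Fin N := fun t => if ht : (h : ℕ) ≤ t then ⟨idx t, hN t ht t.2⟩ else ⟨0, h0⟩
        with hidx'
      have h3 : ∀ t, (h : ℕ) ≤ t → t < H → idx t = ext idx' t := by
        intro t ht htH
        have ht' : h ≤ (⟨t, htH⟩ : Fin H) := ht
        simp [ext, hidx', ht', htH]
      have h2 := hnot.2 (h, fun t => act t, idx')
      have hs' : Spaced H I.M (ext idx') h := by
        intro t ht htH
        rw [← h3 t ht (by omega), ← h3 (t + 1) (by omega) htH]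
        exact hs t ht htH
      simp only [R, if_pos hs', Set.mem_ofPred_eq, not_lt] at h2
      rw [pathDev_congr I ω P p (act' := extendAct fun t : Fin H => act t) (idx' := ext idx')
        (fun t ht => by simp [extendAct, ht]) h3]
      exact h2
  refine (measure_mono hsub).trans ((measure_union_le _ _).trans (add_le_add ?_ ?_))
  · refine (measure_iUnion_le_card_mul _ F fun i =>
      featEst_tail hp I hM hψm hψ (b i.1) (θ i.1 i.2.1) (hθ _ _) i.1 _ (by simp) _ he).trans
      (le_of_eq ?_)
    simp [mul_assoc]
  · refine (measure_iUnion_le_card_mul _ R (b := 2 * Real.exp (-(2 * e ^ 2 * I.M) / H)) fun i => ?_).trans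
      (le_of_eq ?_)
    · by_cases hs : Spaced H I.M (ext i.2.2) i.1
      · simp only [R, if_pos hs]
        exact pathDev_tail hp I hM _ _ _ hs he
      · simp [R, if_neg hs]
    · simp [mul_assoc]

end Concentration

/-! ## Runs of the algorithm on a good tape -/

/-- The condition `a ∉ l` ensures that updating entry `a` leaves the entries already certified
untouched. -/
theorem foldl_finRange_induction {A : ℕ} {β : Type*} (f : β → Fin A → β) (init : β)
    (motive : List (Fin A) → β → Prop) (nil : motive [] init)
    (step : ∀ l a b, a ∉ l → motive l b → motive (l ++ [a]) (f b a)) :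
    motive (List.finRange A) ((List.finRange A).foldl f init) := by
  have key : ∀ l : List (Fin A), l.Nodup → motive l (l.foldl f init) := by
    intro l
    induction l using List.reverseRecOn with
    | nil => exact fun _ => nil
    | append_singleton l a ih =>
      intro hl
      rw [List.foldl_append]
      have h1 := List.nodup_append.1 hl
      exact step l a _ (fun ha => h1.2.2 a ha a (by simp) rfl) (ih h1.1)
  exact key _ (List.nodup_finRange A)

/-! ### The rollout of the main loop. -/

section Rollout

variable {O : Type*} {H k A d : ℕ} [NeZero A]

theorem rollout_data_episodes (I : AlgInput k A d O) (ω : Tape H k A O) (r h : ℕ) (hr : h + r = H)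
    (l : List (Fin A)) (bad : Option (Fin H × List (Fin A) × Feat k A d))
    (st : AlgState H k A d) :
    (rollout I ω r h hr l bad st).2.2.data = st.data ∧
    (rollout I ω r h hr l bad st).2.2.episodes = st.episodes + r * (I.M * A ^ k) := by
  induction r generalizing h l bad st with
  | zero => simp [rollout]
  | succ r ih =>
    rw [rollout]
    refine ⟨(ih _ _ _ _ _).1, (ih _ _ _ _ _).2.trans ?_⟩
    dsimp only
    ring

/-- A recorded feature has to be traced back to an estimate with an explicit first episode `m`; its
norm bound and its accuracy on a good tape come from there. -/
theorem rollout_some (I : AlgInput k A d O) (hM : 0 < I.M) (ω : Tape H k A O) (r h : ℕ)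
    (hr : h + r = H) (l : List (Fin A)) (hl : l.length = h)
    (bad : Option (Fin H × List (Fin A) × Feat k A d)) (st : AlgState H k A d)
    (hbad : ∀ b, bad = some b → b.2.1.length = b.1 ∧
      ¬ sigmaInvNorm I.lam (st.data b.1) b.2.2 ≤ I.eps ∧
      ∃ m < st.episodes, b.2.2 = featEst I ω b.1 b.2.1 m) :
    ∀ b, (rollout I ω r h hr l bad st).1 = some b → b.2.1.length = b.1 ∧
      ¬ sigmaInvNorm I.lam (st.data b.1) b.2.2 ≤ I.eps ∧
      ∃ m < (rollout I ω r h hr l bad st).2.2.episodes, b.2.2 = featEst I ω b.1 b.2.1 m := by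
  induction r generalizing h l bad st with
  | zero => simpa [rollout] using hbad
  | succ r ih =>
    have hpos : 0 < I.M * A ^ k := Nat.mul_pos hM (Nat.pow_pos (Nat.pos_of_neZero A))
    rw [rollout]
    refine ih (h + 1) (by omega) _ (by simp [hl]) _ _ fun b hb => ?_
    split_ifs at hb with hc
    · obtain rfl := Option.some.inj hb
      exact ⟨hl, hc.2, st.episodes, by dsimp only; omega, rfl⟩
    · obtain ⟨h1, h2, m, hm, h3⟩ := hbad b hb
      exact ⟨h1, h2, m, by dsimp only; omega, h3⟩

theorem rollout_bad_none (I : AlgInput k A d O) (ω : Tape H k A O) (r h : ℕ)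
    (hr : h + r = H) (l : List (Fin A)) (bad : Option (Fin H × List (Fin A) × Feat k A d))
    (st : AlgState H k A d) (hnone : (rollout I ω r h hr l bad st).1 = none) : bad = none := by
  induction r generalizing h l bad st with
  | zero => exact hnone
  | succ r ih =>
    have h1 := ih _ _ _ _ _ hnone
    split_ifs at h1
    exact h1

end Rollout

/-! ### Cost accounting and correctness of the recursive computation. -/

section Runs

variable {S O : Type*} [MeasurableSpace S] [MeasurableSpace O] {H k A d : ℕ}

/-- The total number of entries of the data sets. -/
def dataCount (st : AlgState H k A d) : ℕ := ∑ h, (st.data h).length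

/-- All data sets of the state consist of uncovered features. -/
def AllUncovered (lam eps R : ℝ) (st : AlgState H k A d) : Prop :=
  ∀ h, Uncovered lam eps R (st.data h)

/-- The targets in the data sets are the values of the linear functionals `θ h a` up to `e`. -/
def AllAccurate (θ : Fin H → Fin A → Feat k A d) (e : ℝ) (st : AlgState H k A d) : Prop :=
  ∀ h, ∀ c ∈ st.data h, ∀ a, |c.2 a - θ h a ⬝ᵥ c.1| ≤ e

/-- The state `st'` is reached from `st` without a change of the levels below `h`, and with at most
`c` new episodes in addition to `B` for each new entry of a data set. -/
structure Extends (lam eps R : ℝ) (B h c : ℕ) (st st' : AlgState H k A d) : Prop where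
  data_eq : ∀ h' : Fin H, (h' : ℕ) < h → st'.data h' = st.data h'
  episodes_le : st.episodes ≤ st'.episodes
  count_le : dataCount st ≤ dataCount st'
  cost : st'.episodes + dataCount st * B ≤ st.episodes + c + dataCount st' * B
  uncovered : AllUncovered lam eps R st → AllUncovered lam eps R st'

namespace Extends

variable {lam eps R : ℝ} {B h c c' : ℕ} {st st' st'' : AlgState H k A d}

theorem refl (st : AlgState H k A d) : Extends lam eps R B h 0 st st :=
  ⟨fun _ _ => rfl, le_rfl, le_rfl, by simp, id⟩

theorem add_episodes (st : AlgState H k A d) (c : ℕ) :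
    Extends lam eps R B h c st { st with episodes := st.episodes + c } :=
  ⟨fun _ _ => rfl, by simp, le_rfl, by simp [dataCount], id⟩

theorem trans (h1 : Extends lam eps R B h c st st') (h2 : Extends lam eps R B h c' st' st'') :
    Extends lam eps R B h (c + c') st st'' :=
  ⟨fun h' hh => (h2.data_eq h' hh).trans (h1.data_eq h' hh), h1.episodes_le.trans h2.episodes_le,
    h1.count_le.trans h2.count_le, by have := h1.cost; have := h2.cost; omega,
    fun hu => h2.uncovered (h1.uncovered hu)⟩

theorem mono (h1 : Extends lam eps R B h c st st') {h' : ℕ} (hh : h' ≤ h) (hc : c ≤ c') :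
    Extends lam eps R B h' c' st st' :=
  ⟨fun i hi => h1.data_eq i (by omega), h1.episodes_le, h1.count_le,
    by have := h1.cost; omega, h1.uncovered⟩

end Extends

variable [NeZero A]

/-! ### Errors of computed values as deviations along paths. -/

section Paths

variable (I : AlgInput k A d O) (ω : Tape H k A O) (P : POMDP S O A) (p : ℕ → S → Fin A → S)

/-- `x` is the deviation of a sum of reward estimates from step `h` on after the actions `l`, based
on blocks of episodes between `n₀` and `n₁`. -/
def IsPathDev (l : List (Fin A)) (h n₀ n₁ : ℕ) (x : ℝ) : Prop :=
  ∃ (act : ℕ → Fin A) (idx : ℕ → ℕ), pre act h = l ∧ Spaced H I.M idx h ∧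
    (∀ t, h ≤ t → t < H → n₀ ≤ idx t ∧ idx t + I.M ≤ n₁) ∧ pathDev I ω P p act idx h = x

/-- `err` lies between two deviations of sums of reward estimates. -/
def Sandwiched (l : List (Fin A)) (h n₀ n₁ : ℕ) (err : ℝ) : Prop :=
  (∃ x, IsPathDev I ω P p l h n₀ n₁ x ∧ err ≤ x) ∧ ∃ x, IsPathDev I ω P p l h n₀ n₁ x ∧ x ≤ err

variable {I ω P p} {l : List (Fin A)} {n₀ n₁ : ℕ}

theorem IsPathDev.mono {h : ℕ} {x : ℝ} (hx : IsPathDev I ω P p l h n₀ n₁ x) {n₀' n₁' : ℕ}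
    (h0 : n₀' ≤ n₀) (h1 : n₁ ≤ n₁') : IsPathDev I ω P p l h n₀' n₁' x := by
  obtain ⟨act, idx, ha, hs, hb, he⟩ := hx
  exact ⟨act, idx, ha, hs, fun t ht htH => ⟨h0.trans (hb t ht htH).1, (hb t ht htH).2.trans h1⟩, he⟩

theorem IsPathDev.last (hl : l.length = H) : IsPathDev I ω P p l H n₀ n₁ 0 := by
  refine ⟨fun t => l.getD t 0, fun _ => 0, ?_, fun t ht htH => by omega,
    fun t ht htH => by omega, ?_⟩
  · refine List.ext_getElem (by simp [hl]) fun i hi hi' => ?_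
    simp [pre, List.getElem?_eq_getElem hi']
  · refine Finset.sum_eq_zero fun t _ => if_neg (by omega)

/-- The block for step `h` ends before `n₀`, where the later blocks begin, so the extended path is
still spaced. -/
theorem IsPathDev.cons (h : Fin H) (hl : l.length = h) (a : Fin A) {n n₀ n₁ : ℕ} {x : ℝ}
    (hn : n + I.M ≤ n₀) (hn' : n₀ ≤ n₁) (hx : IsPathDev I ω P p (l ++ [a]) (h + 1) n₀ n₁ x) :
    IsPathDev I ω P p l h n n₁ (rewEst I ω h (l ++ [a]) n
      - P.meanRew h (POMDP.stateFrom p 0 P.init l) a + x) := by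
  obtain ⟨act, idx, ha, hs, hb, he⟩ := hx
  rw [pre_succ] at ha
  have hla := List.append_inj ha (by simp [hl])
  have hact : act h = a := by simpa using hla.2
  refine ⟨act, Function.update idx h n, hla.1, ?_, ?_, ?_⟩
  · intro t ht htH
    rcases ht.eq_or_lt with rfl | ht
    · have := (hb (h + 1) le_rfl htH).1
      rw [Function.update_self, Function.update_of_ne (by omega)]
      omega
    · rw [Function.update_of_ne (by omega), Function.update_of_ne (by omega)]
      exact hs t ht htH
  · intro t ht htH
    rcases ht.eq_or_lt with rfl | ht
    · rw [Function.update_self]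
      omega
    · rw [Function.update_of_ne (by omega)]
      have := hb t ht htH
      omega
  · rw [pathDev_eq, rewDev, pre_succ, hla.1, hact, Function.update_self, ← he]
    congr 1
    refine pathDev_congr I ω P p (fun _ _ => rfl) fun t ht _ => ?_
    rw [Function.update_of_ne (by omega)]

theorem Sandwiched.mono {h : ℕ} {x : ℝ} (hx : Sandwiched I ω P p l h n₀ n₁ x) {n₀' n₁' : ℕ}
    (h0 : n₀' ≤ n₀) (h1 : n₁ ≤ n₁') : Sandwiched I ω P p l h n₀' n₁' x := by
  obtain ⟨⟨x, hx, hx'⟩, y, hy, hy'⟩ := hx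
  exact ⟨⟨x, hx.mono h0 h1, hx'⟩, y, hy.mono h0 h1, hy'⟩

theorem Sandwiched.last (hl : l.length = H) : Sandwiched I ω P p l H n₀ n₁ 0 :=
  ⟨⟨0, IsPathDev.last hl, le_rfl⟩, 0, IsPathDev.last hl, le_rfl⟩

theorem Sandwiched.cons (h : Fin H) (hl : l.length = h) (a : Fin A) {n n₀ n₁ : ℕ} {v : ℝ}
    (hn : n + I.M ≤ n₀) (hn' : n₀ ≤ n₁)
    (hx : Sandwiched I ω P p (l ++ [a]) (h + 1) n₀ n₁
      (v - P.vStar p H (h + 1) (POMDP.stateFrom p 0 P.init (l ++ [a])))) :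
    Sandwiched I ω P p l h n n₁ (rewEst I ω h (l ++ [a]) n + v
      - P.qStar p H h (POMDP.stateFrom p 0 P.init l) a) := by
  have hs : POMDP.stateFrom p 0 P.init (l ++ [a])
      = p h (POMDP.stateFrom p 0 P.init l) a := by
    rw [POMDP.stateFrom_append, zero_add, hl]
  rw [hs] at hx
  rw [P.qStar_eq p H h.2]
  obtain ⟨⟨x, hx, hx'⟩, y, hy, hy'⟩ := hx
  exact ⟨⟨_, hx.cons h hl a hn hn', by linarith⟩, _, hy.cons h hl a hn hn', by linarith⟩

/-- For the upper bound take the maximizer of `y`, whose `Q*` is at most `V*`; for the lower bound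
take an optimal action. Each side is the deviation of one path, so maximizing adds no error. -/
theorem Sandwiched.iSup {h : ℕ} {y : Fin A → ℝ}
    (hy : ∀ a, Sandwiched I ω P p l h n₀ n₁
      (y a - P.qStar p H h (POMDP.stateFrom p 0 P.init l) a)) :
    Sandwiched I ω P p l h n₀ n₁
      ((⨆ a, y a) - P.vStar p H h (POMDP.stateFrom p 0 P.init l)) := by
  obtain ⟨a, ha⟩ := exists_eq_ciSup_of_finite (f := y)
  obtain ⟨a', ha'⟩ := P.exists_qStar_eq_vStar p H h (POMDP.stateFrom p 0 P.init l)
  obtain ⟨x, hx, hx'⟩ := (hy a).1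
  obtain ⟨z, hz, hz'⟩ := (hy a').2
  have h1 := P.qStar_le_vStar p H h (POMDP.stateFrom p 0 P.init l) a
  have h2 := le_ciSup (Set.finite_range y).bddAbove a'
  exact ⟨⟨x, hx, by linarith⟩, z, hz, by linarith⟩

theorem Sandwiched.abs_le {θ : Fin H → Fin A → Feat k A d} {e : ℝ} {N : ℕ}
    (hg : GoodTape I P p θ e N ω) (hM : 0 < I.M) (h : Fin H) {x : ℝ} (hN : n₁ ≤ N)
    (hx : Sandwiched I ω P p l h n₀ n₁ x) : |x| ≤ e := by
  have key : ∀ y, IsPathDev I ω P p l h n₀ n₁ y → |y| ≤ e := by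
    rintro y ⟨act, idx, -, hs, hb, rfl⟩
    refine hg.rew h act idx hs fun t ht htH => ?_
    have := hb t ht htH
    omega
  obtain ⟨⟨y, hy, hy'⟩, z, hz, hz'⟩ := hx
  have h1 := _root_.abs_le.1 (key y hy)
  have h2 := _root_.abs_le.1 (key z hz)
  exact _root_.abs_le.2 ⟨by linarith, by linarith⟩

end Paths

/-- The tape is good for the algorithm: the estimates are accurate, greedy actions at covered
features are optimal, and uncovered lists have at most `n` entries. -/
structure Favorable (I : AlgInput k A d O) (P : POMDP S O A) (p : ℕ → S → Fin A → S)
    (θ : Fin H → Fin A → Feat k A d) (e : ℝ) (N n : ℕ) (ω : Tape H k A O) : Prop where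
  good : GoodTape I P p θ e N ω
  M_pos : 0 < I.M
  norm_le : ∀ o, ‖I.ψ o‖ ≤ 1
  length_le : ∀ D : Dataset k A d, Uncovered I.lam I.eps ((A : ℝ) ^ k) D → D.length ≤ n
  greedy : ∀ (h : Fin H) (D : Dataset k A d) (act : ℕ → Fin A) (m : ℕ), m < N →
    Uncovered I.lam I.eps ((A : ℝ) ^ k) D → (∀ c ∈ D, ∀ a, |c.2 a - θ h a ⬝ᵥ c.1| ≤ 2 * e) →
    sigmaInvNorm I.lam D (featEst I ω h (pre act h) m) ≤ I.eps →
    P.qStar p H h (POMDP.stateFrom p 0 P.init (pre act h))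
        (I.amax fun a => thetaHat I.lam D a ⬝ᵥ featEst I ω h (pre act h) m)
      = P.vStar p H h (POMDP.stateFrom p 0 P.init (pre act h))

variable {I : AlgInput k A d O} {P : POMDP S O A} {p : ℕ → S → Fin A → S}
  {θ : Fin H → Fin A → Feat k A d} {e : ℝ} {N n : ℕ} {ω : Tape H k A O}

theorem exists_pre_eq (l : List (Fin A)) : ∃ act : ℕ → Fin A, pre act l.length = l := by
  refine ⟨fun t => l.getD t 0, List.ext_getElem (by simp) fun i hi hi' => ?_⟩
  simp [pre, List.getElem?_eq_getElem hi']

theorem Favorable.greedy_list (hF : Favorable I P p θ e N n ω) (h : Fin H) (D : Dataset k A d)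
    (l : List (Fin A)) (hl : l.length = h) (m : ℕ) (hm : m < N)
    (hu : Uncovered I.lam I.eps ((A : ℝ) ^ k) D)
    (ha : ∀ c ∈ D, ∀ a, |c.2 a - θ h a ⬝ᵥ c.1| ≤ 2 * e)
    (hc : sigmaInvNorm I.lam D (featEst I ω h l m) ≤ I.eps) :
    P.qStar p H h (POMDP.stateFrom p 0 P.init l)
        (I.amax fun a => thetaHat I.lam D a ⬝ᵥ featEst I ω h l m)
      = P.vStar p H h (POMDP.stateFrom p 0 P.init l) := by
  obtain ⟨act, hact⟩ := exists_pre_eq l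
  rw [hl] at hact
  subst hact
  exact hF.greedy h D act m hm hu ha hc

theorem Favorable.feat_list (hF : Favorable I P p θ e N n ω) (h : Fin H) (l : List (Fin A))
    (hl : l.length = h) (m : ℕ) (hm : m < N) (a : Fin A) :
    |θ h a ⬝ᵥ featEst I ω h l m - P.qStar p H h (POMDP.stateFrom p 0 P.init l) a| ≤ e := by
  obtain ⟨act, hact⟩ := exists_pre_eq l
  rw [hl] at hact
  subst hact
  exact hF.good.feat h a act m hm

/-- A correct value computation at step `h` from `st` after the actions `l`. -/
def CorrectValue (I : AlgInput k A d O) (P : POMDP S O A) (p : ℕ → S → Fin A → S)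
    (θ : Fin H → Fin A → Feat k A d) (e : ℝ) (N : ℕ) (ω : Tape H k A O) (B h c : ℕ)
    (l : List (Fin A)) (st : AlgState H k A d) (out : ℝ × AlgState H k A d) : Prop :=
  Extends I.lam I.eps ((A : ℝ) ^ k) B h c st out.2 ∧
  (out.2.episodes ≤ N → AllUncovered I.lam I.eps ((A : ℝ) ^ k) st → AllAccurate θ (2 * e) st →
    AllAccurate θ (2 * e) out.2 ∧
    Sandwiched I ω P p l h st.episodes out.2.episodes
      (out.1 - P.vStar p H h (POMDP.stateFrom p 0 P.init l)))

/-- The calls to `next` change only levels above `h`, so `x` is still uncovered when it is appended.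
The new entry pays for the `A` reward estimates and calls through `B`, hence the residual cost `0`.
The target accuracy `2 * e` is `e` from the reward path plus `e` from the feature estimate. -/
theorem explore_spec (hF : Favorable I P p θ e N n ω) {B c : ℕ} (hB : A * (I.M + c) ≤ B)
    (h : Fin H) (l : List (Fin A)) (hl : l.length = h) (x : Feat k A d)
    (next : List (Fin A) → AlgState H k A d → ℝ × AlgState H k A d)
    (hnext : ∀ l' st', l'.length = (h : ℕ) + 1 →
      CorrectValue I P p θ e N ω B (h + 1) c l' st' (next l' st'))
    (st : AlgState H k A d) (hxR : x ⬝ᵥ x ≤ (A : ℝ) ^ k)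
    (hx : ¬ sigmaInvNorm I.lam (st.data h) x ≤ I.eps)
    (hxθ : st.episodes ≤ N → ∀ a,
      |θ h a ⬝ᵥ x - P.qStar p H h (POMDP.stateFrom p 0 P.init l) a| ≤ e) :
    Extends I.lam I.eps ((A : ℝ) ^ k) B h 0 st (explore I ω h l x next st).2 ∧
    dataCount st < dataCount (explore I ω h l x next st).2 ∧
    ((explore I ω h l x next st).2.episodes ≤ N → AllUncovered I.lam I.eps ((A : ℝ) ^ k) st →
      AllAccurate θ (2 * e) st →
      AllAccurate θ (2 * e) (explore I ω h l x next st).2 ∧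
      ∀ a, Sandwiched I ω P p l h st.episodes (explore I ω h l x next st).2.episodes
        ((explore I ω h l x next st).1 a
          - P.qStar p H h (POMDP.stateFrom p 0 P.init l) a)) := by
  have key := foldl_finRange_induction
    (fun (acc : (Fin A → ℝ) × AlgState H k A d) a' =>
      let r := rewEst I ω h (l ++ [a']) acc.2.episodes
      let out := next (l ++ [a']) { acc.2 with episodes := acc.2.episodes + I.M }
      (Function.update acc.1 a' (r + out.1), out.2))
    ((fun _ => 0), st)
    (fun la acc => Extends I.lam I.eps ((A : ℝ) ^ k) B (h + 1) (la.length * (I.M + c)) st acc.2 ∧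
      (acc.2.episodes ≤ N → AllUncovered I.lam I.eps ((A : ℝ) ^ k) st →
        AllAccurate θ (2 * e) st →
        AllAccurate θ (2 * e) acc.2 ∧
        ∀ a ∈ la, Sandwiched I ω P p l h st.episodes acc.2.episodes
          (acc.1 a - P.qStar p H h (POMDP.stateFrom p 0 P.init l) a)))
    ⟨by simpa using Extends.refl st, fun _ _ hacc => ⟨hacc, by simp⟩⟩
    (by
      rintro la a ⟨y, st₁⟩ hla ⟨hext, hcor⟩
      obtain ⟨hext', hcor'⟩ := hnext (l ++ [a]) { st₁ with episodes := st₁.episodes + I.M }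
        (by simp [hl])
      dsimp only at hext hcor hext' hcor' ⊢
      set out := next (l ++ [a]) { st₁ with episodes := st₁.episodes + I.M } with hout
      have hep : st₁.episodes + I.M ≤ out.2.episodes := hext'.episodes_le
      refine ⟨?_, fun hN hu hacc => ?_⟩
      · have := (hext.trans (Extends.add_episodes st₁ I.M)).trans hext'
        refine this.mono le_rfl (le_of_eq ?_)
        simp only [List.length_append, List.length_singleton]
        ring
      · obtain ⟨hacc1, hs1⟩ := hcor (by omega) hu hacc
        obtain ⟨hacc2, hs2⟩ := hcor' hN (hext.uncovered hu) hacc1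
        refine ⟨hacc2, fun a' ha' => ?_⟩
        rcases List.mem_append.1 ha' with ha' | ha'
        · have hne : a' ≠ a := fun h0 => hla (h0 ▸ ha')
          rw [Function.update_of_ne hne]
          exact (hs1 a' ha').mono le_rfl (by omega)
        · obtain rfl := List.mem_singleton.1 ha'
          rw [Function.update_self]
          exact (hs2.cons h hl a' (n := st₁.episodes) le_rfl hep).mono hext.episodes_le le_rfl)
  rw [explore]
  dsimp only at key ⊢
  set res := (List.finRange A).foldl
    (fun (acc : (Fin A → ℝ) × AlgState H k A d) a' =>
      (Function.update acc.1 a' (rewEst I ω h (l ++ [a']) acc.2.episodes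
        + (next (l ++ [a']) { acc.2 with episodes := acc.2.episodes + I.M }).1),
        (next (l ++ [a']) { acc.2 with episodes := acc.2.episodes + I.M }).2))
    ((fun _ => 0), st) with hres
  obtain ⟨hext, hcor⟩ := key
  rw [List.length_finRange] at hext
  have hdata : res.2.data h = st.data h := hext.data_eq h (by omega)
  have hcount : dataCount ({ res.2 with
      data := Function.update res.2.data h (res.2.data h ++ [(x, res.1)]) } : AlgState H k A d)
      = dataCount res.2 + 1 := by
    simp only [dataCount]
    rw [← Finset.add_sum_erase _ _ (Finset.mem_univ h),
      ← Finset.add_sum_erase _ (fun i => (res.2.data i).length) (Finset.mem_univ h),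
      Function.update_self, List.length_append, List.length_singleton]
    have : ∑ i ∈ Finset.univ.erase h,
        (Function.update res.2.data h (res.2.data h ++ [(x, res.1)]) i).length
        = ∑ i ∈ Finset.univ.erase h, (res.2.data i).length :=
      Finset.sum_congr rfl fun i hi => by rw [Function.update_of_ne (Finset.ne_of_mem_erase hi)]
    omega
  refine ⟨⟨fun h' hh => ?_, hext.episodes_le, ?_, ?_, fun hu => ?_⟩, ?_, fun hN hu hacc => ?_⟩
  · dsimp only
    rw [Function.update_of_ne (fun h0 => by rw [h0] at hh; omega)]
    exact hext.data_eq h' (by omega)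
  · have := hext.count_le
    rw [hcount]
    omega
  · have := hext.cost
    rw [hcount, add_mul]
    dsimp only
    omega
  · intro h'
    dsimp only
    rcases eq_or_ne h' h with rfl | hne
    · rw [Function.update_self]
      refine Uncovered.append _ _ _ (hext.uncovered hu h') hxR ?_
      rwa [hdata]
    · rw [Function.update_of_ne hne]
      exact hext.uncovered hu h'
  · have := hext.count_le
    rw [hcount]
    omega
  · obtain ⟨hacc', hs⟩ := hcor hN hu hacc
    have hs' : ∀ a, _ := fun a => hs a (List.mem_finRange a)
    refine ⟨fun h' => ?_, hs'⟩
    dsimp only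
    rcases eq_or_ne h' h with rfl | hne
    · rw [Function.update_self]
      intro c hc a
      rcases List.mem_append.1 hc with hc | hc
      · exact hacc' h' c hc a
      · obtain rfl := List.mem_singleton.1 hc
        have h1 := abs_le.1 ((hs' a).abs_le hF.good hF.M_pos h' hN)
        have h2 := abs_le.1 (hxθ (hext.episodes_le.trans hN) a)
        exact abs_le.2 ⟨by linarith, by linarith⟩
    · rw [Function.update_of_ne hne]
      exact hacc' h'

/-- At a covered feature the greedy action attains `V*`, so the path is extended with no error
beyond that of the reward estimate; at an uncovered one the maximum over actions is sandwiched. Each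
level costs at most `M * (A ^ k + A)` episodes besides what new entries pay for. -/
theorem computeV_spec (hF : Favorable I P p θ e N n ω) (r h : ℕ) (hr : h + r = H)
    (l : List (Fin A)) (hl : l.length = h) (st : AlgState H k A d) :
    CorrectValue I P p θ e N ω (A * (H * (I.M * (A ^ k + A)))) h (r * (I.M * (A ^ k + A))) l st
      (computeV I ω r h hr l st) := by
  induction r using Nat.strong_induction_on generalizing h l st with
  | _ r ih =>
  have hA : 1 ≤ A := Nat.one_le_iff_ne_zero.2 (NeZero.ne A)
  have hAk : 1 ≤ A ^ k := Nat.one_le_pow _ _ hA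
  match r with
  | 0 =>
    obtain rfl : h = H := by omega
    rw [computeV]
    refine ⟨by simpa using Extends.refl st, fun _ _ hacc => ⟨hacc, ?_⟩⟩
    simpa [POMDP.vStar_self] using Sandwiched.last hl
  | 1 =>
    rw [computeV]
    refine ⟨(Extends.add_episodes st (I.M * A)).mono le_rfl (by nlinarith), fun _ _ hacc =>
      ⟨hacc, Sandwiched.iSup fun a => ?_⟩⟩
    have ha : (a : ℕ) + 1 ≤ A := a.2
    have ha' : I.M * a + I.M ≤ I.M * A := by
      calc I.M * a + I.M = I.M * (a + 1) := by ring
        _ ≤ _ := Nat.mul_le_mul_left _ ha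
    have h1 : h + 1 = H := hr
    have h2 := Sandwiched.cons (I := I) (ω := ω) (P := P) (p := p) ⟨h, by omega⟩ hl a
      (n := st.episodes + I.M * a) (n₀ := st.episodes + I.M * A) (n₁ := st.episodes + I.M * A)
      (v := 0) (by omega) le_rfl (by
        subst h1
        simp only [POMDP.vStar_self, sub_self]
        exact Sandwiched.last (by simp [hl]))
    simp only [add_zero] at h2
    exact h2.mono (by omega) le_rfl
  | r + 2 =>
    have hMA : 1 ≤ I.M * A ^ k := Nat.one_le_iff_ne_zero.2
      (Nat.mul_ne_zero hF.M_pos.ne' (by omega))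
    rw [computeV]
    dsimp only
    split_ifs with hcov
    · set a := I.amax fun a => thetaHat I.lam (st.data ⟨h, by omega⟩) a ⬝ᵥ
        featEst I ω ⟨h, by omega⟩ l st.episodes with ha
      obtain ⟨hext, hcor⟩ := ih (r + 1) (by omega) (h + 1) (by omega) (l ++ [a]) (by simp [hl])
        { st with episodes := st.episodes + I.M * A ^ k + I.M }
      set out := computeV I ω (r + 1) (h + 1) (by omega) (l ++ [a])
        { st with episodes := st.episodes + I.M * A ^ k + I.M } with hout
      have hep : st.episodes + I.M * A ^ k + I.M ≤ out.2.episodes := hext.episodes_le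
      refine ⟨?_, fun hN hu hacc => ?_⟩
      · have := (Extends.add_episodes (lam := I.lam) (eps := I.eps) (R := (A : ℝ) ^ k)
          (B := A * (H * (I.M * (A ^ k + A)))) (h := h) st (I.M * A ^ k)).trans
          (Extends.add_episodes _ I.M) |>.trans (hext.mono (h' := h) (by omega) le_rfl)
        refine this.mono le_rfl ?_
        nlinarith
      · obtain ⟨hacc', hs⟩ := hcor hN hu hacc
        refine ⟨hacc', ?_⟩
        have h1 := hF.greedy_list ⟨h, by omega⟩ _ l hl st.episodes (by dsimp only at hN; omega)
          (hu _) (hacc _) hcov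
        have h2 := (hs.cons ⟨h, by omega⟩ hl a (n := st.episodes + I.M * A ^ k) le_rfl hep).mono
          (n₀' := st.episodes) (by omega) le_rfl
        rw [← ha] at h1
        rw [← h1]
        exact h2
    · have hexp := explore_spec hF (B := A * (H * (I.M * (A ^ k + A))))
        (c := (r + 1) * (I.M * (A ^ k + A))) (by
          refine Nat.mul_le_mul_left _ ?_
          have h3 : r + 2 ≤ H := by omega
          have h4 : I.M ≤ I.M * (A ^ k + A) := Nat.le_mul_of_pos_right _ (by omega)
          have h5 : (r + 2) * (I.M * (A ^ k + A)) ≤ H * (I.M * (A ^ k + A)) :=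
            Nat.mul_le_mul_right _ h3
          nlinarith)
        ⟨h, by omega⟩ l hl (featEst I ω ⟨h, by omega⟩ l st.episodes)
        (fun l' st' => computeV I ω (r + 1) (h + 1) (by omega) l' st')
        (fun l' st' hl' => ih (r + 1) (by omega) (h + 1) (by omega) l' hl' st')
        { st with episodes := st.episodes + I.M * A ^ k }
        (featEst_dotProduct_self_le I hF.norm_le ω _ l _) hcov
        (fun hN a => hF.feat_list _ l hl _ (by dsimp only at hN; omega) a)
      obtain ⟨hext, -, hcor⟩ := hexp
      refine ⟨?_, fun hN hu hacc => ?_⟩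
      · have := (Extends.add_episodes (lam := I.lam) (eps := I.eps) (R := (A : ℝ) ^ k)
          (B := A * (H * (I.M * (A ^ k + A)))) (h := h) st (I.M * A ^ k)).trans hext
        refine this.mono le_rfl ?_
        have h6 : I.M * A ^ k ≤ I.M * (A ^ k + A) := Nat.mul_le_mul_left _ (by omega)
        exact h6.trans (Nat.le_mul_of_pos_left _ (by omega))
      · obtain ⟨hacc', hs⟩ := hcor hN hu hacc
        exact ⟨hacc', Sandwiched.iSup fun a => (hs a).mono (by simp) le_rfl⟩

/-- The invariant `hopt` says that the mean rewards so far plus the optimal remaining value make up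
the optimal total. With no recorded level every feature was covered, and exact greedy actions
preserve it. -/
theorem rollout_none (hF : Favorable I P p θ e N n ω) (r h : ℕ)
    (hr : h + r = H) (l : List (Fin A)) (hl : l.length = h)
    (bad : Option (Fin H × List (Fin A) × Feat k A d)) (st : AlgState H k A d)
    (hN : st.episodes + r * (I.M * A ^ k) ≤ N)
    (hu : AllUncovered I.lam I.eps ((A : ℝ) ^ k) st) (hacc : AllAccurate θ (2 * e) st)
    (hnone : (rollout I ω r h hr l bad st).1 = none)
    (hopt : P.pathMean p 0 P.init l + P.vStar p H h (POMDP.stateFrom p 0 P.init l)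
      = P.vStar p H 0 P.init) :
    (rollout I ω r h hr l bad st).2.1.length = H ∧
      P.pathMean p 0 P.init (rollout I ω r h hr l bad st).2.1 = P.vStar p H 0 P.init := by
  induction r generalizing h l bad st with
  | zero =>
    obtain rfl : h = H := by omega
    rw [POMDP.vStar_self, add_zero] at hopt
    exact ⟨hl, hopt⟩
  | succ r ih =>
    have hpos : 0 < I.M * A ^ k := Nat.mul_pos hF.M_pos (Nat.pow_pos (Nat.pos_of_neZero A))
    have hsplit : (r + 1) * (I.M * A ^ k) = r * (I.M * A ^ k) + I.M * A ^ k := by ring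
    rw [rollout] at hnone ⊢
    have hcov : sigmaInvNorm I.lam (st.data ⟨h, by omega⟩)
        (featEst I ω ⟨h, by omega⟩ l st.episodes) ≤ I.eps := by
      by_contra hc
      have hb := rollout_bad_none I ω _ _ _ _ _ _ hnone
      split_ifs at hb with hb'
      exact hb' ⟨hb, hc⟩
    have h1 := hF.greedy_list ⟨h, by omega⟩ _ l hl st.episodes (by omega) (hu _) (hacc _) hcov
    refine ih (h + 1) (by omega) _ (by simp [hl]) _ _ (by dsimp only; omega) hu hacc hnone ?_
    rw [POMDP.pathMean_append, POMDP.stateFrom_append, zero_add, hl, ← hopt, ← h1,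
      P.qStar_eq p H (by omega), add_assoc]

theorem dataCount_le (hF : Favorable I P p θ e N n ω) {st : AlgState H k A d}
    (hu : AllUncovered I.lam I.eps ((A : ℝ) ^ k) st) : dataCount st ≤ H * n := by
  refine (Finset.sum_le_sum fun h _ => hF.length_le _ (hu h)).trans ?_
  simp

/-- Each iteration that does not stop adds an entry, and there are at most `H * n` entries. With `T
= H * (M * (A ^ k + A))`, an entry pays `A * T` for its exploration and `T` for a rollout; the last
rollout is extra. The count of entries uses only that they were uncovered, so the episodes are known
to stay below `N` before accuracy is invoked, and there is no circularity. -/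
theorem mainLoop_spec (hF : Favorable I P p θ e N n ω) (hp : P.IsDeterministic p)
    (hN : H * n * ((A + 1) * (H * (I.M * (A ^ k + A)))) + H * (I.M * (A ^ k + A)) ≤ N) (f : ℕ)
    (st : AlgState H k A d) (hf : H * n < f + dataCount st)
    (hep : st.episodes ≤ dataCount st * ((A + 1) * (H * (I.M * (A ^ k + A)))))
    (hu : AllUncovered I.lam I.eps ((A : ℝ) ^ k) st) (hacc : AllAccurate θ (2 * e) st) :
    ∃ l st', mainLoop I ω f st = some (l, st') ∧ P.IsOptimalActions H l ∧ st'.episodes ≤ N := by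
  induction f generalizing st with
  | zero =>
    have := dataCount_le hF hu
    omega
  | succ f ih =>
    set T := H * (I.M * (A ^ k + A)) with hT
    have hHM : H * (I.M * A ^ k) ≤ T := by
      rw [hT]
      gcongr
      omega
    have hcnt : ∀ st : AlgState H k A d, AllUncovered I.lam I.eps ((A : ℝ) ^ k) st →
        dataCount st * ((A + 1) * T) ≤ H * n * ((A + 1) * T) := fun st hu =>
      Nat.mul_le_mul_right _ (dataCount_le hF hu)
    have hc0 := hcnt st hu
    obtain ⟨hdata, hep'⟩ := rollout_data_episodes I ω H 0 (Nat.zero_add H) [] none st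
    have hsome := rollout_some I hF.M_pos ω H 0 (Nat.zero_add H) [] rfl none st (by simp)
    have hnone := rollout_none hF H 0 (Nat.zero_add H) [] rfl none st (by omega) hu hacc
    rcases hroll : rollout I ω H 0 (Nat.zero_add H) [] none st with ⟨_ | ⟨h, l, x⟩, l', st'⟩
    · simp only [hroll] at hnone hep'
      refine ⟨l', st', by simp only [mainLoop, hroll], ?_, by omega⟩
      obtain ⟨h1, h2⟩ := hnone trivial (by simp [POMDP.pathMean, POMDP.stateFrom])
      exact POMDP.isOptimalActions_of_pathMean_eq H hp h1 h2
    · simp only [hroll] at hsome hep' hdata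
      simp only [mainLoop, hroll]
      obtain ⟨hl, hx, m, hm, hxm⟩ := hsome _ rfl
      dsimp only at hl hx hxm
      have hu' : AllUncovered I.lam I.eps ((A : ℝ) ^ k) st' := fun i => by rw [hdata]; exact hu i
      have hacc' : AllAccurate θ (2 * e) st' := fun i => by rw [hdata]; exact hacc i
      have hcount : dataCount st' = dataCount st := by simp only [dataCount, hdata]
      have hMT : I.M + (H - (h + 1)) * (I.M * (A ^ k + A)) ≤ T := by
        have h1 : I.M ≤ I.M * (A ^ k + A) :=
          Nat.le_mul_of_pos_right _ (by have := Nat.pos_of_neZero A; omega)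
        have h2 : (H - (h + 1) + 1) * (I.M * (A ^ k + A)) ≤ T :=
          Nat.mul_le_mul_right _ (by omega)
        rw [add_mul, one_mul] at h2
        omega
      obtain ⟨hext, hlt, hcor⟩ := explore_spec hF (B := A * T)
        (c := (H - (h + 1)) * (I.M * (A ^ k + A))) (Nat.mul_le_mul_left _ hMT) h l hl x
        (fun l' st'' => computeV I ω (H - (h + 1)) (h + 1) (by omega) l' st'')
        (fun l' st'' hl' => computeV_spec hF _ _ _ l' hl' st'') st'
        (by rw [hxm]; exact featEst_dotProduct_self_le I hF.norm_le ω _ l _)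
        (by rw [hdata]; exact hx)
        (fun hN a => by rw [hxm]; exact hF.feat_list _ l hl _ (by omega) a)
      set out := explore I ω h l x
        (fun l' st'' => computeV I ω (H - (h + 1)) (h + 1) (by omega) l' st'') st' with hout
      have hu'' := hext.uncovered hu'
      have hc1 := hcnt out.2 hu''
      have hcost := hext.cost
      have hmul : (dataCount st + 1) * T ≤ dataCount out.2 * T :=
        Nat.mul_le_mul_right _ (by omega)
      have hep'' : out.2.episodes ≤ dataCount out.2 * ((A + 1) * T) := by
        rw [hcount] at hcost
        have e1 : ∀ c, c * ((A + 1) * T) = c * (A * T) + c * T := fun c => by ring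
        rw [e1] at hep ⊢
        rw [add_mul, one_mul] at hmul
        omega
      exact ih out.2 (by omega) hep'' hu'' (hcor (by omega) hu' hacc').1

end Runs

/-! ## Greedy actions and the linear functionals -/

section Functionals

variable {S O : Type*} [MeasurableSpace S] [MeasurableSpace O] {H k A d : ℕ} {P : POMDP S O A}
  {p : ℕ → S → Fin A → S}

theorem exists_qStar_eq_inner {ds : ℕ} {φ : S → EuclideanSpace ℝ (Fin ds)}
    {ψ : (Fin (k + 1) → O) → EuclideanSpace ℝ (Fin d)} {G : Fin H → Matrix (Fin d) (Fin ds) ℝ}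
    {W Θ : ℝ} (hΘ : 1 ≤ Θ) (hΘW : Θ = W / ⨅ h : Fin H, smallestSingularValue (G h))
    (hlin : ∀ (h : Fin H) (a : Fin A), ∃ w : EuclideanSpace ℝ (Fin ds),
      ‖w‖ ≤ W ∧ ∀ s, P.qStar p H h s a = inner ℝ w (φ s))
    {b : Fin H → Fin k → Fin A} {L : Fin H → Matrix (Fin ds) (Fin d) ℝ}
    (hL : ∀ h, L h * G h = 1)
    (hb : ∀ (h : Fin H) s, ∫ o, ψ o ∂(P.window k h (b h) s) = Matrix.toEuclideanLin (G h) (φ s))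
    (h : Fin H) (a : Fin A) :
    ∃ θ : EuclideanSpace ℝ (Fin d), ‖θ‖ ≤ Θ ∧
      ∀ s, P.qStar p H h s a = inner ℝ θ (∫ o, ψ o ∂(P.window k h (b h) s)) := by
  set σ := ⨅ h : Fin H, smallestSingularValue (G h)
  have hσ : 0 < σ := by
    refine lt_of_le_of_ne (Real.iInf_nonneg fun h => LinearMap.singularValues_nonneg _ _) ?_
    -- A vanishing infimum would give `Θ = W / 0 = 0`, against `1 ≤ Θ`.
    intro h0
    rw [← h0, div_zero] at hΘW
    linarith
  obtain ⟨w, hw, hq⟩ := hlin h a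
  obtain ⟨θ, hθ, hi⟩ := exists_inner_toEuclideanLin_eq (G h) (L h) (hL h) hσ
    (ciInf_le (Set.finite_range _).bddBelow h) w hw
  exact ⟨θ, hΘW ▸ hθ, fun s => by rw [hq, hb, hi]⟩

end Functionals

section Greedy

variable {S O : Type*} [MeasurableSpace S] [MeasurableSpace O] {H k A d : ℕ} [NeZero A]
  {I : AlgInput k A d O} {P : POMDP S O A} {p : ℕ → S → Fin A → S}
  {θ : Fin H → Fin A → Feat k A d} {e : ℝ} {N n : ℕ} {ω : Tape H k A O}

/-- All predictions are within less than `Δ / 2` of `Q*`, so they cannot rank an action of gap at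
least `Δ` above an optimal one. -/
theorem GoodTape.favorable (hg : GoodTape I P p θ e N ω) (hM : 0 < I.M)
    (hψ : ∀ o, ‖I.ψ o‖ ≤ 1) (hlam : 0 < I.lam) (heps : 0 ≤ I.eps) (he : 0 ≤ e)
    (hamax : ∀ (f : Fin A → ℝ) (a : Fin A), f a ≤ f (I.amax f)) {Θ Δ : ℝ} (hΘ : 0 ≤ Θ)
    (hθ : ∀ h a, θ h a ⬝ᵥ θ h a ≤ Θ ^ 2)
    (hgap : ∀ (h : Fin H) (s : S) (a : Fin A), 0 < P.gap p H h s a → Δ ≤ P.gap p H h s a)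
    (hlen : ∀ m : ℕ, (1 + I.eps ^ 2) ^ m ≤ (1 + m * (A : ℝ) ^ k / I.lam) ^ (A ^ k * d) → m ≤ n)
    (hΔ : I.eps * (√n * (2 * e) + √I.lam * Θ) + e < Δ / 2) :
    Favorable I P p θ e N n ω := by
  have hlength : ∀ D : Dataset k A d, Uncovered I.lam I.eps ((A : ℝ) ^ k) D → D.length ≤ n :=
    fun D hD => hlen _ (hD.pow_le hlam heps)
  refine ⟨hg, hM, hψ, hlength, fun h D act m hm hu hacc hcov => ?_⟩
  set x := featEst I ω h (pre act h) m with hx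
  set s := POMDP.stateFrom p 0 P.init (pre act h) with hs
  have hpred : ∀ a, |thetaHat I.lam D a ⬝ᵥ x - P.qStar p H h s a|
      ≤ I.eps * (√n * (2 * e) + √I.lam * Θ) + e := by
    intro a
    have h1 := thetaHat_error hlam D a x (θ h a) (e := 2 * e) (by linarith) hΘ (hθ h a)
      fun c hc => hacc c hc a
    have h2 : sigmaInvNorm I.lam D x * (√D.length * (2 * e) + √I.lam * Θ)
        ≤ I.eps * (√n * (2 * e) + √I.lam * Θ) := by
      have : (D.length : ℝ) ≤ n := Nat.cast_le.2 (hlength D hu)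
      gcongr
    have h3 := hg.feat h a act m hm
    have h4 := abs_sub_le (thetaHat I.lam D a ⬝ᵥ x) (θ h a ⬝ᵥ x) (P.qStar p H h s a)
    linarith
  set a := I.amax fun a => thetaHat I.lam D a ⬝ᵥ x with ha
  obtain ⟨a', ha'⟩ := P.exists_qStar_eq_vStar p H h s
  have h1 := abs_le.1 (hpred a)
  have h2 := abs_le.1 (hpred a')
  have h3 : thetaHat I.lam D a' ⬝ᵥ x ≤ thetaHat I.lam D a ⬝ᵥ x :=
    hamax (fun a => thetaHat I.lam D a ⬝ᵥ x) a'
  by_contra hne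
  have h4 : 0 < P.gap p H h s a :=
    sub_pos.2 (lt_of_le_of_ne (P.qStar_le_vStar p H h s a) hne)
  have h5 := hgap h s a h4
  rw [POMDP.gap] at h5
  linarith

end Greedy

/-! ## Choice of the parameters -/

section Parameters

/-- This solves the elliptical potential inequality for `m`. With `y = m / D`, logarithms give `y
log 2 ≤ 8 log 2 + 6 L + y / 4`, and `log 2 > 1 / 4` leaves `y ≤ 28 L`. -/
theorem le_of_two_pow_le {m D : ℕ} {X L Y : ℝ} (hD : 0 < D) (hL : 1 ≤ L) (hX : 1 ≤ X)
    (hLX : L = Real.log X) (hY : 0 ≤ Y) (hYX : D * Y ≤ 64 * X ^ 6)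
    (h : (2 : ℝ) ^ m ≤ (1 + m * Y) ^ D) : (m : ℝ) ≤ 28 * D * L := by
  have hD' : (0 : ℝ) < D := Nat.cast_pos.2 hD
  set y : ℝ := m / D with hy
  have hm : (m : ℝ) = D * y := by rw [hy]; field_simp
  have hy0 : 0 ≤ y := by positivity
  have h1 : m * Real.log 2 ≤ D * Real.log (1 + m * Y) := by
    have := Real.log_le_log (by positivity) h
    rwa [Real.log_pow, Real.log_pow] at this
  have h2 : 1 + m * Y ≤ 256 * X ^ 6 * ((1 + y) / 4) := by
    have h3 : m * Y ≤ 64 * X ^ 6 * y := by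
      rw [hm]
      nlinarith
    have h4 : 1 ≤ X ^ 6 := one_le_pow₀ hX
    nlinarith
  have h3 : Real.log (1 + m * Y) ≤ 8 * Real.log 2 + 6 * L + y / 4 := by
    refine (Real.log_le_log (by positivity) h2).trans ?_
    rw [Real.log_mul (by positivity) (by positivity), Real.log_mul (by norm_num) (by positivity),
      Real.log_pow, ← hLX, show (256 : ℝ) = 2 ^ 8 by norm_num, Real.log_pow]
    -- The factor `1 / 4` was split off to make the slope in `y` smaller than `log 2`.
    have := Real.log_le_sub_one_of_pos (show 0 < (1 + y) / 4 by positivity)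
    push_cast
    linarith
  have hl1 := Real.log_two_gt_d9
  have hl2 := Real.log_two_lt_d9
  have h4 : y * Real.log 2 ≤ 8 * Real.log 2 + 6 * L + y / 4 := by
    have : D * (y * Real.log 2) ≤ D * (8 * Real.log 2 + 6 * L + y / 4) := by
      calc D * (y * Real.log 2) = m * Real.log 2 := by rw [hm]; ring
        _ ≤ _ := h1.trans (by gcongr)
    exact le_of_mul_le_mul_left this hD'
  have h5 : y ≤ 28 * L := by nlinarith
  rw [hm]
  nlinarith

/-- The error budget: `Δ / 8` from the targets, `Δ / 8` from the regularization and `Δ / 16` from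
the feature estimate. -/
theorem sqrt_error_lt {n : ℕ} {B Θ Δ : ℝ} (hn : n ≤ B) (hB : 1 ≤ B) (hΘ : 0 < Θ) (hΔ : 0 < Δ) :
    1 * (√n * (2 * (Δ / (16 * √B))) + √((Δ / (8 * Θ)) ^ 2) * Θ) + Δ / (16 * √B) < Δ / 2 := by
  have h1 : 1 ≤ √B := Real.one_le_sqrt.2 hB
  have h2 : √n ≤ √B := Real.sqrt_le_sqrt hn
  rw [Real.sqrt_sq (by positivity)]
  have h3 : √n * (2 * (Δ / (16 * √B))) ≤ Δ / 8 := by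
    calc √n * (2 * (Δ / (16 * √B))) ≤ √B * (2 * (Δ / (16 * √B))) := by gcongr
      _ = Δ / 8 := by field_simp; norm_num
  have h4 : Δ / (8 * Θ) * Θ = Δ / 8 := by field_simp
  have h5 : Δ / (16 * √B) ≤ Δ / 16 := by
    gcongr
    linarith
  linarith

theorem mul_exp_neg_le {Y q δ : ℝ} (hY : 0 < Y) (hδ : 0 < δ)
    (hq : Real.log 4 + Real.log Y + Real.log (1 / δ) ≤ q) : Y * (2 * Real.exp (-q)) ≤ δ / 2 := by
  have h1 : Real.exp (-q) ≤ δ / (4 * Y) := by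
    rw [← Real.le_log_iff_exp_le (by positivity), Real.log_div hδ.ne' (by positivity),
      Real.log_mul (by norm_num) hY.ne']
    rw [one_div, Real.log_inv] at hq
    linarith
  calc Y * (2 * Real.exp (-q)) ≤ Y * (2 * (δ / (4 * Y))) := by gcongr
    _ = δ / 2 := by field_simp; norm_num

/-- The total number of episodes in terms of the parameters. -/
theorem episodes_le {H k A n M : ℕ} {B : ℝ} (hH : 1 ≤ H) (hA : 2 ≤ A) (hB : 1 ≤ B) (hn : n ≤ B) :
    ((H * n * ((A + 1) * (H * (M * (A ^ k + A)))) + H * (M * (A ^ k + A)) : ℕ) : ℝ)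
      ≤ 4 * H ^ 2 * B * M * A ^ (k + 2) := by
  have hH' : (1 : ℝ) ≤ H := by exact_mod_cast hH
  have hA' : (2 : ℝ) ≤ A := by exact_mod_cast hA
  have hAk : (1 : ℝ) ≤ (A : ℝ) ^ k := one_le_pow₀ (by linarith)
  push_cast
  have h1 : (A : ℝ) ^ k + A ≤ 2 * A ^ (k + 1) := by
    rw [pow_succ]
    nlinarith
  have h2 : (H : ℝ) * n * (A + 1) + 1 ≤ 2 * A * (H * B) := by
    have h3 : (H : ℝ) * n ≤ H * B := by gcongr
    have h4 : 1 ≤ H * B := by nlinarith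
    nlinarith
  calc (H : ℝ) * n * ((A + 1) * (H * (M * (A ^ k + A)))) + H * (M * (A ^ k + A))
      = (H * n * (A + 1) + 1) * (H * M * (A ^ k + A)) := by ring
    _ ≤ (2 * A * (H * B)) * (H * M * (2 * A ^ (k + 1))) := by gcongr
    _ = _ := by ring

theorem log_card_le {H A : ℕ} {N L : ℝ} (hH : 1 ≤ H) (hA : 1 ≤ A) (hN : 1 ≤ N) (hL : 0 ≤ L)
    (hHL : Real.log H ≤ L) (hAL : Real.log A ≤ L) (hNL : Real.log N ≤ 37 * L) :
    Real.log (H * A * A ^ H * N ^ H) ≤ 40 * (H * L) := by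
  have hH' : (1 : ℝ) ≤ H := by exact_mod_cast hH
  have hA' : (1 : ℝ) ≤ A := by exact_mod_cast hA
  rw [Real.log_mul (by positivity) (by positivity), Real.log_mul (by positivity) (by positivity),
    Real.log_mul (by positivity) (by positivity), Real.log_pow, Real.log_pow]
  have h1 : H * Real.log A ≤ H * L := by gcongr
  have h2 : H * Real.log N ≤ H * (37 * L) := by gcongr
  have h3 : L ≤ H * L := by nlinarith
  linarith

theorem log_episodes_le {X L N : ℝ} (hX : 0 < X) (hLX : L = Real.log X) (hL : 1 ≤ L) (hN : 0 < N)
    (h : N ≤ 2 ^ 30 * X ^ 16) : Real.log N ≤ 37 * L := by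
  refine (Real.log_le_log hN h).trans ?_
  rw [Real.log_mul (by norm_num) (by positivity), Real.log_pow, Real.log_pow, ← hLX]
  have := Real.log_two_lt_d9
  push_cast
  linarith

/-- The exponents of the tail bounds dominate the number of events. -/
theorem exponent_le {H : ℕ} {D Θ Δ L ℓ M Z : ℝ} (hH : 1 ≤ H) (hD : 0 < D) (hΘ : 0 < Θ) (hΔ : 0 < Δ)
    (hL : 1 ≤ L) (hℓ : 1 / 2 ≤ ℓ) (hZ : Z ≤ 40 * (H * L))
    (hM : 2 ^ 22 * (D * H ^ 2 * (Θ / Δ) ^ 2 * L ^ 2 * ℓ) ≤ M) :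
    Real.log 4 + Z + ℓ ≤ (Δ / (16 * √(28 * D * L))) ^ 2 * M / (2 * Θ ^ 2 * H) := by
  have hH' : (1 : ℝ) ≤ H := by exact_mod_cast hH
  have hℓ0 : 0 < ℓ := by linarith
  have h1 : 292 * (H * L * ℓ) ≤ (Δ / (16 * √(28 * D * L))) ^ 2 * M / (2 * Θ ^ 2 * H) := by
    rw [div_pow, mul_pow, Real.sq_sqrt (by positivity)]
    -- Here `14336 = 2 * 16 ^ 2 * 28`, collected from `e ^ 2` and the denominator.
    calc 292 * (H * L * ℓ) ≤ (2 ^ 22 / 14336) * (H * L * ℓ) := by gcongr; norm_num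
      _ = Δ ^ 2 / (16 ^ 2 * (28 * D * L)) * (2 ^ 22 * (D * H ^ 2 * (Θ / Δ) ^ 2 * L ^ 2 * ℓ))
          / (2 * Θ ^ 2 * H) := by field_simp; norm_num
      _ ≤ _ := by gcongr
  have h4 : Real.log 4 ≤ 2 := by
    rw [show (4 : ℝ) = 2 ^ 2 by norm_num, Real.log_pow]
    have := Real.log_two_lt_d9
    push_cast
    linarith
  have h5 : 1 ≤ H * L := by nlinarith
  have h6 : ℓ ≤ H * L * ℓ := by nlinarith
  have h7 : H * L ≤ 2 * (H * L * ℓ) := by nlinarith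
  linarith

/-- Only `log N` matters for the union bound, so a crude power of `X` suffices: it makes `log N` a
multiple of `L`, which is known before `M` is chosen. -/
theorem count_monomial_le {X L H D Θ Δ ℓ A N : ℝ} {k : ℕ} (hX : 0 < X) (hLX : L ≤ X) (hL : 0 < L)
    (hHX : H ≤ X) (hH : 0 < H) (hDX : D ≤ X) (hD : 0 < D) (hΘX : Θ ≤ X) (hΘ : 0 < Θ)
    (hΔX : 1 / Δ ≤ X) (hΔ : 0 < 1 / Δ) (hℓX : ℓ ≤ X) (hℓ : 0 < ℓ) (hAX : A ≤ X) (hA : 0 < A)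
    (hAkX : A ^ (k + 1) ≤ X)
    (hN : N ≤ 112 * 2 ^ 23 *
      (H ^ 2 * D * L * (D * H ^ 2 * (Θ / Δ) ^ 2 * L ^ 2 * ℓ) * A ^ (k + 2))) :
    N ≤ 2 ^ 30 * X ^ 16 := by
  have h1 : H ^ 2 * D * L ≤ X ^ 2 * X * X := by gcongr
  have h2 : Θ / Δ ≤ X * X := by
    rw [← mul_one_div]
    gcongr
  have h2' : 0 < Θ / Δ := by
    rw [← mul_one_div]
    positivity
  have h3 : D * H ^ 2 * (Θ / Δ) ^ 2 * L ^ 2 * ℓ ≤ X * X ^ 2 * (X * X) ^ 2 * X ^ 2 * X := by gcongr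
  have h4 : A ^ (k + 2) ≤ X * X := by
    rw [pow_succ]
    gcongr
  have h5 : H ^ 2 * D * L * (D * H ^ 2 * (Θ / Δ) ^ 2 * L ^ 2 * ℓ) * A ^ (k + 2)
      ≤ (X ^ 2 * X * X) * (X * X ^ 2 * (X * X) ^ 2 * X ^ 2 * X) * (X * X) := by gcongr
  have h6 : (X ^ 2 * X * X) * (X * X ^ 2 * (X * X) ^ 2 * X ^ 2 * X) * (X * X) = X ^ 16 := by ring
  rw [h6] at h5
  have h7 : 0 ≤ X ^ 16 := by positivity
  norm_num at hN ⊢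
  linarith

/-- One factor `A ^ k * d` comes from the number of entries and one from `M`; with `A ^ (k + 2)`
from the cost per entry the power of `A` is `3 K - 1`. The square of `Θ / Δ ≥ 1` is relaxed to its
fifth power. -/
theorem samples_monomial_le {H T L d Θ Δ ℓ A N : ℝ} {k : ℕ} (hN0 : 0 ≤ N) (hH : 0 < H)
    (hA : 0 < A) (hΘΔ : 1 ≤ Θ / Δ) (hL : 0 < L) (hℓ : 0 < ℓ)
    (hT : T ≤ H * (2 * L))
    (hN : N ≤ 112 * 2 ^ 23 *
      (H ^ 2 * (A ^ k * d) * L * (A ^ k * d * H ^ 2 * (Θ / Δ) ^ 2 * L ^ 2 * ℓ) * A ^ (k + 2))) :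
    N * T ≤ 2 ^ 31 * L ^ 4 *
      (H ^ 5 * (A ^ k * A ^ k * A ^ (k + 2)) * d ^ 2 * (Θ ^ 5 * (1 / Δ) ^ 5) * ℓ) := by
  have h1 : (Θ / Δ) ^ 2 ≤ Θ ^ 5 * (1 / Δ) ^ 5 := by
    rw [← mul_pow, mul_one_div]
    exact pow_le_pow_right₀ hΘΔ (by norm_num)
  have h2 : N * T ≤ 112 * 2 ^ 23 *
      (H ^ 2 * (A ^ k * d) * L * (A ^ k * d * H ^ 2 * (Θ / Δ) ^ 2 * L ^ 2 * ℓ) * A ^ (k + 2))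
        * (H * (2 * L)) :=
    (mul_le_mul_of_nonneg_left hT hN0).trans (mul_le_mul_of_nonneg_right hN (by positivity))
  have h3 : L ^ 4 * (H ^ 5 * (A ^ k * A ^ k * A ^ (k + 2)) * d ^ 2 * (Θ / Δ) ^ 2 * ℓ)
      ≤ L ^ 4 * (H ^ 5 * (A ^ k * A ^ k * A ^ (k + 2)) * d ^ 2 * (Θ ^ 5 * (1 / Δ) ^ 5) * ℓ) := by
    gcongr
  have h4 : 0 ≤ L ^ 4 * (H ^ 5 * (A ^ k * A ^ k * A ^ (k + 2)) * d ^ 2 * (Θ / Δ) ^ 2 * ℓ) := by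
    positivity
  calc N * T ≤ _ := h2
    _ = 224 * 2 ^ 23 *
        (L ^ 4 * (H ^ 5 * (A ^ k * A ^ k * A ^ (k + 2)) * d ^ 2 * (Θ / Δ) ^ 2 * ℓ)) := by ring
    _ ≤ 2 ^ 31 *
        (L ^ 4 * (H ^ 5 * (A ^ k * A ^ k * A ^ (k + 2)) * d ^ 2 * (Θ / Δ) ^ 2 * ℓ)) :=
      mul_le_mul_of_nonneg_right (by norm_num) h4
    _ ≤ 2 ^ 31 *
        (L ^ 4 * (H ^ 5 * (A ^ k * A ^ k * A ^ (k + 2)) * d ^ 2 * (Θ ^ 5 * (1 / Δ) ^ 5) * ℓ)) :=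
      mul_le_mul_of_nonneg_left h3 (by norm_num)
    _ = _ := by ring

theorem exists_parameters (H k d A : ℕ) (Θ Δ δ : ℝ) (hH : 1 ≤ H) (hd : 1 ≤ d) (hA : 2 ≤ A)
    (hΘ : 1 ≤ Θ) (hΔ : 0 < Δ) (hΔΘ : Δ ≤ Θ) (hδ : 0 < δ) (hδ2 : δ ≤ 1 / 2) :
    ∃ (lam e : ℝ) (M n N : ℕ), 0 < lam ∧ 0 ≤ e ∧ 1 ≤ M ∧
      (∀ m : ℕ, (1 + (1 : ℝ) ^ 2) ^ m ≤ (1 + m * (A : ℝ) ^ k / lam) ^ (A ^ k * d) → m ≤ n) ∧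
      1 * (√n * (2 * e) + √lam * Θ) + e < Δ / 2 ∧
      H * n * ((A + 1) * (H * (M * (A ^ k + A)))) + H * (M * (A ^ k + A)) ≤ N ∧
      H * A * A ^ H * N * (2 * Real.exp (-(e ^ 2 * M) / (2 * Θ ^ 2))) ≤ δ / 2 ∧
      H * A ^ H * N ^ H * (2 * Real.exp (-(2 * e ^ 2 * M) / H)) ≤ δ / 2 ∧
      (N : ℝ) * (H + k) ≤ 2 ^ 31 *
        Real.log (2 + H + d * A ^ (k + 1) + Θ + 1 / Δ + Real.log (1 / δ)) ^ 4 *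
        (H ^ 5 * Θ ^ 5 * A ^ (3 * (k + 1) - 1) * d ^ 2 * (1 / Δ) ^ 5 * Real.log (1 / δ)) := by
  obtain ⟨ℓ, hℓdef⟩ : ∃ ℓ, ℓ = Real.log (1 / δ) := ⟨_, rfl⟩
  rw [← hℓdef]
  obtain ⟨X, hXdef⟩ : ∃ X : ℝ, X = 2 + H + d * A ^ (k + 1) + Θ + 1 / Δ + ℓ := ⟨_, rfl⟩
  rw [← hXdef]
  obtain ⟨L, hLdef⟩ : ∃ L, L = Real.log X := ⟨_, rfl⟩
  rw [← hLdef]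
  have hℓ : 1 / 2 ≤ ℓ := by
    have h1 : Real.log 2 ≤ ℓ := hℓdef ▸ Real.log_le_log (by norm_num) (by
      rw [le_div_iff₀ hδ]; linarith)
    have := Real.log_two_gt_d9
    linarith
  have hℓ0 : 0 < ℓ := by linarith
  have hH' : (1 : ℝ) ≤ H := by exact_mod_cast hH
  have hd' : (1 : ℝ) ≤ d := by exact_mod_cast hd
  have hA' : (2 : ℝ) ≤ A := by exact_mod_cast hA
  have hA1 : (1 : ℝ) ≤ A := by linarith
  have hAk : (1 : ℝ) ≤ (A : ℝ) ^ k := one_le_pow₀ hA1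
  have hΔi : 0 < 1 / Δ := by positivity
  have hdA : (2 : ℝ) ≤ d * A ^ (k + 1) := by
    calc (2 : ℝ) ≤ A ^ (k + 1) := hA'.trans (le_self_pow₀ hA1 (by omega))
      _ ≤ _ := le_mul_of_one_le_left (by positivity) hd'
  have hX6 : 6 ≤ X := by linarith
  have hX1 : 1 ≤ X := by linarith
  have hX0 : 0 < X := by linarith
  have hL1 : 1 ≤ L := by
    rw [hLdef, Real.le_log_iff_exp_le hX0]
    have := Real.exp_one_lt_d9
    linarith
  have hL0 : 0 < L := by linarith
  have hLX : L ≤ X := hLdef ▸ Real.log_le_self hX0.le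
  have hHX : (H : ℝ) ≤ X := by linarith
  have hdAX : (d : ℝ) * A ^ (k + 1) ≤ X := by linarith
  have hAkX' : (A : ℝ) ^ (k + 1) ≤ X :=
    (le_mul_of_one_le_left (by positivity) hd').trans hdAX
  have hAX : (A : ℝ) ≤ X := (le_self_pow₀ hA1 (by omega)).trans hAkX'
  have hAkX : (A : ℝ) ^ k ≤ X := (pow_le_pow_right₀ hA1 (by omega)).trans hAkX'
  have hΘX : Θ ≤ X := by linarith
  have hΔX : 1 / Δ ≤ X := by linarith
  have hℓX : ℓ ≤ X := by linarith
  obtain ⟨D, hDdef⟩ : ∃ D : ℝ, D = ((A ^ k * d : ℕ) : ℝ) := ⟨_, rfl⟩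
  have hDeq : D = A ^ k * d := by rw [hDdef]; push_cast; ring
  have hD1 : 1 ≤ D := by rw [hDeq]; exact one_le_mul_of_one_le_of_one_le hAk hd'
  have hDX : D ≤ X := by
    rw [hDeq]
    refine le_trans ?_ hdAX
    rw [mul_comm]
    exact mul_le_mul_of_nonneg_left (pow_le_pow_right₀ hA1 (by omega)) (by linarith)
  have hB : 1 ≤ 28 * D * L := one_le_mul_of_one_le_of_one_le (by linarith) hL1
  have hΘΔ : 1 ≤ Θ / Δ := (one_le_div hΔ).2 hΔΘ
  obtain ⟨m, hmdef⟩ : ∃ m : ℝ, m = D * H ^ 2 * (Θ / Δ) ^ 2 * L ^ 2 * ℓ := ⟨_, rfl⟩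
  have hm : 1 / 2 ≤ m := by
    have h1 : 1 ≤ D * H ^ 2 * (Θ / Δ) ^ 2 * L ^ 2 :=
      one_le_mul_of_one_le_of_one_le (one_le_mul_of_one_le_of_one_le
        (one_le_mul_of_one_le_of_one_le hD1 (one_le_pow₀ hH')) (one_le_pow₀ hΘΔ)) (one_le_pow₀ hL1)
    rw [hmdef]
    exact hℓ.trans (le_mul_of_one_le_left hℓ0.le h1)
  obtain ⟨M, hM1, hM2⟩ : ∃ M : ℕ, 2 ^ 22 * m ≤ M ∧ (M : ℝ) ≤ 2 ^ 23 * m := by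
    -- Rounding up at most doubles, since `m ≥ 1 / 2`.
    have := Nat.ceil_lt_add_one (show 0 ≤ 2 ^ 22 * m by linarith)
    exact ⟨⌈2 ^ 22 * m⌉₊, Nat.le_ceil _, by linarith⟩
  have hM : 1 ≤ M := Nat.one_le_iff_ne_zero.2 (by
    intro h0
    rw [h0, Nat.cast_zero] at hM1
    linarith)
  obtain ⟨n, hndef⟩ : ∃ n : ℕ, n = ⌊28 * D * L⌋₊ := ⟨_, rfl⟩
  have hn : (n : ℝ) ≤ 28 * D * L := hndef ▸ Nat.floor_le (by linarith)
  obtain ⟨N, hNdef⟩ : ∃ N : ℕ, N = H * n * ((A + 1) * (H * (M * (A ^ k + A)))) + H * (M * (A ^ k + A)) := ⟨_, rfl⟩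
  have hN1 : 1 ≤ N := by
    have : 0 < H * (M * (A ^ k + A)) := by positivity
    omega
  have hN1' : (1 : ℝ) ≤ N := by exact_mod_cast hN1
  have hN : (N : ℝ) ≤ 112 * 2 ^ 23 * (H ^ 2 * D * L * m * A ^ (k + 2)) := by
    rw [hNdef]
    refine (episodes_le hH hA hB hn).trans ?_
    calc 4 * (H : ℝ) ^ 2 * (28 * D * L) * M * A ^ (k + 2)
        ≤ 4 * (H : ℝ) ^ 2 * (28 * D * L) * (2 ^ 23 * m) * A ^ (k + 2) := by gcongr
      _ = _ := by ring
  have hNX := count_monomial_le (k := k) hX0 hLX hL0 hHX (by linarith) hDX (by linarith) hΘX (by linarith)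
    hΔX hΔi hℓX hℓ0 hAX (by linarith) hAkX' (hmdef ▸ hN)
  have hZ := log_card_le (L := L) hH (by omega) hN1' hL0.le
    (hLdef.symm ▸ Real.log_le_log (by linarith) hHX)
    (hLdef.symm ▸ Real.log_le_log (by linarith) hAX)
    (log_episodes_le hX0 hLdef hL1 (by linarith) hNX)
  have hq := exponent_le (D := D) (Θ := Θ) hH (by linarith) (by linarith) hΔ hL1 hℓ hZ
    (hmdef ▸ hM1)
  obtain ⟨e, hedef⟩ : ∃ e : ℝ, e = Δ / (16 * √(28 * D * L)) := ⟨_, rfl⟩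
  rw [← hedef] at hq
  have he : 0 < e := by rw [hedef]; positivity
  have hΘ1 : 1 ≤ Θ ^ 2 := one_le_pow₀ hΘ
  have hYpos : (0 : ℝ) < H * A * A ^ H * N ^ H := by positivity
  have hexp := mul_exp_neg_le hYpos hδ (hℓdef ▸ hq)
  -- Both tail exponents dominate this common one, and both event counts are at most `H * A * A ^ H
  -- * N ^ H`, so `hexp` serves both unions.
  have hq1 : e ^ 2 * M / (2 * Θ ^ 2 * H) ≤ e ^ 2 * M / (2 * Θ ^ 2) := by
    refine div_le_div_of_nonneg_left (by positivity) (by positivity) ?_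
    exact le_mul_of_one_le_right (by positivity) hH'
  have hq2 : e ^ 2 * M / (2 * Θ ^ 2 * H) ≤ 2 * e ^ 2 * M / H := by
    rw [div_le_div_iff₀ (by positivity) (by positivity)]
    calc e ^ 2 * M * H ≤ e ^ 2 * M * H * (4 * Θ ^ 2) :=
          le_mul_of_one_le_right (by positivity) (by linarith)
      _ = _ := by ring
  -- From `2 ^ (k + 1) ≤ A ^ (k + 1) ≤ X`. The episode length is thus at most `2 H L`, the source of
  -- the fourth factor `L`.
  have hAkL : (k : ℝ) + 1 ≤ 2 * L := by
    have h1 : ((k + 1 : ℕ) : ℝ) * Real.log 2 ≤ L := by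
      rw [← Real.log_pow, hLdef]
      exact Real.log_le_log (by positivity)
        ((pow_le_pow_left₀ (by norm_num) hA' _).trans hAkX')
    have h2 : (k + 1 : ℝ) * (1 / 2) ≤ (k + 1) * Real.log 2 := by
      have := Real.log_two_gt_d9
      gcongr
      linarith
    push_cast at h1
    linarith
  refine ⟨(Δ / (8 * Θ)) ^ 2, e, M, n, N, by positivity, he.le, hM, fun i hi => ?_,
    hedef ▸ sqrt_error_lt hn hB (by linarith) hΔ, hNdef.ge, ?_, ?_, ?_⟩
  · rw [hndef, hDdef]
    refine Nat.le_floor ?_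
    refine le_of_two_pow_le (m := i) (D := A ^ k * d) (X := X) (L := L)
      (Y := (A : ℝ) ^ k / (Δ / (8 * Θ)) ^ 2) (by positivity) hL1 hX1 hLdef (by positivity) ?_ ?_
    · rw [← hDdef]
      calc D * ((A : ℝ) ^ k / (Δ / (8 * Θ)) ^ 2) = 64 * (D * A ^ k * Θ ^ 2 * (1 / Δ) ^ 2) := by
            field_simp; norm_num
        _ ≤ 64 * (X * X * X ^ 2 * X ^ 2) := by gcongr
        _ = _ := by ring
    · rw [← mul_div_assoc]
      convert hi using 2
      norm_num
  · refine le_trans ?_ hexp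
    rw [neg_div]
    have : (N : ℝ) ≤ N ^ H := le_self_pow₀ hN1' (by omega)
    gcongr
  · refine le_trans ?_ hexp
    rw [neg_div]
    have : (H : ℝ) ≤ H * A := le_mul_of_one_le_right (by linarith) hA1
    gcongr
  · have hHk : (H : ℝ) + k ≤ H * (2 * L) := by
      calc (H : ℝ) + k ≤ H + H * k := by
            gcongr
            exact le_mul_of_one_le_left (Nat.cast_nonneg k) hH'
        _ = H * (k + 1) := by ring
        _ ≤ _ := by gcongr
    refine (samples_monomial_le (by positivity) (by linarith) (by linarith) hΘΔ hL0 hℓ0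
      hHk (hDeq ▸ hmdef ▸ hN)).trans (le_of_eq ?_)
    rw [show 3 * (k + 1) - 1 = k + k + (k + 2) by omega, pow_add _ (k + k), pow_add _ k k]
    ring

end Parameters

end HSEPOMDP

/-! ### The main theorem. -/

theorem mainTheorem4 :
    ∃ (C : ℝ) (q : ℕ), 0 < C ∧
    -- the future length is `K = k + 1`
    ∀ (H k d A : ℕ) [NeZero A] (Θ Δ δ : ℝ),
      1 ≤ H → 1 ≤ d → 2 ≤ A → 1 ≤ Θ → 0 < Δ → Δ ≤ Θ → 0 < δ → δ ≤ 1 / 2 →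
    ∃ (lam ε : ℝ) (M : ℕ), 0 < lam ∧ 0 < ε ∧ 1 ≤ M ∧
    ∀ {S O : Type*} [MeasurableSpace S] [MeasurableSpace O] (P : HSEPOMDP.POMDP S O A)
      (p : ℕ → S → Fin A → S) (ds : ℕ) (φ : S → EuclideanSpace ℝ (Fin ds))
      (ψ : (Fin (k + 1) → O) → EuclideanSpace ℝ (Fin d))
      (G : Fin H → Matrix (Fin d) (Fin ds) ℝ) (W : ℝ)
      (amax : (Fin A → ℝ) → Fin A),
      -- deterministic transitions
      P.IsDeterministic p →
      -- linear optimal `Q`-function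
      (∀ (h : Fin H) (a : Fin A), ∃ w : EuclideanSpace ℝ (Fin ds),
        ‖w‖ ≤ W ∧ ∀ s, P.qStar p H h s a = inner ℝ w (φ s)) →
      -- optimality gap
      (∀ (h : Fin H) (s : S) (a : Fin A), 0 < P.gap p H h s a → Δ ≤ P.gap p H h s a) →
      -- left-invertible linear embedding of the `K`-step future
      (∀ h : Fin H, (∃ L : Matrix (Fin ds) (Fin d) ℝ, L * G h = 1) ∧
        ∃ b : Fin k → Fin A, ∀ s,
          ∫ o, ψ o ∂(P.window k h b s) = Matrix.toEuclideanLin (G h) (φ s)) →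
      Measurable ψ → (∀ o, ‖ψ o‖ ≤ 1) →
      Θ = W / ⨅ h : Fin H, HSEPOMDP.smallestSingularValue (G h) →
      -- `amax` is a rule for choosing a maximizer
      Measurable amax → (∀ (f : Fin A → ℝ) (a : Fin A), f a ≤ f (amax f)) →
      -- except with probability at most `δ`, the output is optimal and the sample bound holds
      HSEPOMDP.tapeLaw P H k
        {ω | ¬ ∃ (l : List (Fin A)) (N : ℕ),
          HSEPOMDP.Outputs ⟨lam, ε, M, ψ, amax⟩ ω l N ∧
          P.IsOptimalActions H l ∧
          (N : ℝ) ≤ C * Real.log (2 + H + d * A ^ (k + 1) + Θ + 1 / Δ + Real.log (1 / δ)) ^ q *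
            (H ^ 5 * Θ ^ 5 * A ^ (3 * (k + 1) - 1) * d ^ 2 * (1 / Δ) ^ 5 * Real.log (1 / δ))}
        ≤ ENNReal.ofReal δ := by
  refine ⟨2 ^ 31, 4, by norm_num, ?_⟩
  intro H k d A _ Θ Δ δ hH hd hA hΘ hΔ hΔΘ hδ hδ2
  obtain ⟨lam, e, M, n, N, hlam, he, hM, hlen, herr, hN, hp1, hp2, hbound⟩ :=
    HSEPOMDP.exists_parameters H k d A Θ Δ δ hH hd hA hΘ hΔ hΔΘ hδ hδ2
  refine ⟨lam, 1, M, hlam, one_pos, hM, ?_⟩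
  intro S O _ _ P p ds φ ψ G W amax hp hlin hgap hobs hψm hψ hΘW _ hamax
  choose hL b hb using hobs
  choose L hL using hL
  choose θ hθ hq using HSEPOMDP.exists_qStar_eq_inner (b := b) (P := P) hΘ hΘW hlin hL hb
  set I : HSEPOMDP.AlgInput k A d O := ⟨lam, 1, M, ψ, amax⟩ with hI
  have hgood := HSEPOMDP.goodTape_compl hp I hM hψm hψ b θ hθ hq he N
  refine (measure_mono ?_).trans (hgood.trans ?_)
  · intro ω hω hg
    refine hω ?_
    have hF := HSEPOMDP.GoodTape.favorable (Θ := Θ) (Δ := Δ) (n := n) hg hM hψ hlam zero_le_one he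
      hamax (by linarith)
      (fun h a => by
        rw [HSEPOMDP.blockVec_dotProduct_self]
        exact pow_le_pow_left₀ (norm_nonneg _) (hθ h a) 2)
      hgap hlen herr
    -- At most `H * n` iterations can add an entry, and one more is needed to stop.
    obtain ⟨l, st, hrun, hopt, hst⟩ := HSEPOMDP.mainLoop_spec hF hp hN (H * n + 1)
      { episodes := 0, data := fun _ => [] } (by omega) (by simp)
      (fun _ => HSEPOMDP.Uncovered.nil) (fun _ => by simp)
    refine ⟨l, st.episodes * (H + k), ⟨_, st, hrun, rfl⟩, hopt, le_trans ?_ hbound⟩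
    have : (st.episodes : ℝ) ≤ N := Nat.cast_le.2 hst
    push_cast
    gcongr
  · rw [← ENNReal.ofReal_add (by positivity) (by positivity)]
    exact ENNReal.ofReal_le_ofReal (by linarith)
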